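/- Let $\mathfrak{C}^C$ be the complexified Cayley algebra with basis $e_0=1,e_1,\dots,e_7$, where $e_i^2=-1$ and $e_ie_j=-e_je_i$ for distinct $i,j\ge 1$, and $e_1e_2=e_3$, $e_1e_4=e_5$, $e_1e_6=e_7$, $e_2e_5=e_7$, $e_2e_6=e_4$, $e_3e_4=e_7$, $e_3e_5=e_6$ together with the cyclic permutations of these relations; let $x\mapsto\overline{x}$ be the $\mathbb{C}$-linear conjugation fixing $e_0$ and negating $e_1,\dots,e_7$. Let $\mathfrak{J}^C$ be the complex exceptional Jordan algebra of $3\times 3$ matrices $X$ over $\mathfrak{C}^C$ that equal the transpose of their entrywise conjugate, with $X\circ Y=\frac12(XY+YX)$, and let $${F_4}^C=\{\alpha\in\mathrm{Iso}_{\mathbb{C}}(\mathfrak{J}^C)\mid \alpha(X\circ Y)=\alpha X\circ\alpha Y \text{ for all } X,Y\in\mathfrak{J}^C\}.$$ Let $E_i\in\mathfrak{J}^C$ $(i=1,2,3)$ be the matrix with $1$ in position $(i,i)$ and zeros elsewhere, and for $x\in\mathfrak{C}^C$ let $F_1(x)\in\mathfrak{J}^C$ be the matrix with $x$ in position $(2,3)$,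 $\overline{x}$ in position $(3,2)$ and zeros elsewhere. **Theorem 3.16.** The group $$({F_4}^C)_{E_1,E_2,E_3,F_1(e_0),F_1(e_1)}=\{\alpha\in {F_4}^C\mid \alpha E_i=E_i\ (i=1,2,3),\ \alpha F_1(e_k)=F_1(e_k)\ (k=0,1)\}$$ is isomorphic, as a complex Lie group, to $\mathrm{Spin}(6,\mathbb{C})$, the spin group of the quadratic form $z_1^2+\dots+z_6^2$ on $\mathbb{C}^6$. That is, there is a group isomorphism between them that is holomorphic in both directions, where the first group carries its complex Lie group structure as a closed subgroup of $\mathrm{GL}_{\mathbb{C}}(\mathfrak{J}^C)$ and the second its structure as a closed subgroup of the unit group of the Clifford algebra. -/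

import Mathlib

open scoped Matrix

namespace F4C

/-! ### The complex Cayley algebra -/

/-- The complexified Cayley algebra `ℭ^C`: an element is `x₀ e₀ + x₁ e₁ + ⋯ + x₇ e₇` with complex
coordinates `xₖ`. -/
@[ext]
structure CayleyC where
  /-- The coordinates in the basis `e₀, …, e₇`. -/
  coord : Fin 8 → ℂ

namespace CayleyC

/-- The identification of `ℭ^C` with `ℂ⁸`. -/
def coordEquiv : CayleyC ≃ (Fin 8 → ℂ) where
  toFun x := x.coord
  invFun v := ⟨v⟩
  left_inv _ := rfl
  right_inv _ := rfl

/-- Coordinatewise addition. -/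
noncomputable instance : AddCommGroup CayleyC := coordEquiv.addCommGroup

/-- Coordinatewise scalar multiplication. -/
noncomputable instance : Module ℂ CayleyC := coordEquiv.module ℂ

/-- The basis element `eₖ` of `ℭ^C`. -/
noncomputable def e (k : Fin 8) : CayleyC := ⟨Pi.single k 1⟩

/-- Cayley multiplication: the `ℂ`-bilinear product with unit `e₀`, `eᵢ² = -e₀` and
`eᵢ eⱼ = -eⱼ eᵢ` for distinct `i, j ≥ 1`, and
`e₁e₂ = e₃`, `e₁e₄ = e₅`, `e₁e₆ = e₇`, `e₂e₅ = e₇`, `e₂e₆ = e₄`, `e₃e₄ = e₇`, `e₃e₅ = e₆`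
together with the cyclic permutations of these seven relations. -/
noncomputable instance : Mul CayleyC :=
  ⟨fun x y => ⟨![
    x.coord 0 * y.coord 0 - x.coord 1 * y.coord 1 - x.coord 2 * y.coord 2 - x.coord 3 * y.coord 3
      - x.coord 4 * y.coord 4 - x.coord 5 * y.coord 5 - x.coord 6 * y.coord 6 - x.coord 7 * y.coord 7,
    x.coord 0 * y.coord 1 + x.coord 1 * y.coord 0 + (x.coord 2 * y.coord 3 - x.coord 3 * y.coord 2)
      + (x.coord 4 * y.coord 5 - x.coord 5 * y.coord 4) + (x.coord 6 * y.coord 7 - x.coord 7 * y.coord 6),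
    x.coord 0 * y.coord 2 + x.coord 2 * y.coord 0 + (x.coord 3 * y.coord 1 - x.coord 1 * y.coord 3)
      + (x.coord 6 * y.coord 4 - x.coord 4 * y.coord 6) + (x.coord 5 * y.coord 7 - x.coord 7 * y.coord 5),
    x.coord 0 * y.coord 3 + x.coord 3 * y.coord 0 + (x.coord 1 * y.coord 2 - x.coord 2 * y.coord 1)
      + (x.coord 4 * y.coord 7 - x.coord 7 * y.coord 4) + (x.coord 5 * y.coord 6 - x.coord 6 * y.coord 5),
    x.coord 0 * y.coord 4 + x.coord 4 * y.coord 0 + (x.coord 5 * y.coord 1 - x.coord 1 * y.coord 5)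
      + (x.coord 2 * y.coord 6 - x.coord 6 * y.coord 2) + (x.coord 7 * y.coord 3 - x.coord 3 * y.coord 7),
    x.coord 0 * y.coord 5 + x.coord 5 * y.coord 0 + (x.coord 1 * y.coord 4 - x.coord 4 * y.coord 1)
      + (x.coord 7 * y.coord 2 - x.coord 2 * y.coord 7) + (x.coord 6 * y.coord 3 - x.coord 3 * y.coord 6),
    x.coord 0 * y.coord 6 + x.coord 6 * y.coord 0 + (x.coord 7 * y.coord 1 - x.coord 1 * y.coord 7)
      + (x.coord 4 * y.coord 2 - x.coord 2 * y.coord 4) + (x.coord 3 * y.coord 5 - x.coord 5 * y.coord 3),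
    x.coord 0 * y.coord 7 + x.coord 7 * y.coord 0 + (x.coord 1 * y.coord 6 - x.coord 6 * y.coord 1)
      + (x.coord 2 * y.coord 5 - x.coord 5 * y.coord 2) + (x.coord 3 * y.coord 4 - x.coord 4 * y.coord 3)]⟩⟩

/-- Cayley conjugation: the `ℂ`-linear map fixing `e₀` and negating `e₁, …, e₇`. -/
noncomputable instance : Star CayleyC :=
  ⟨fun x => ⟨![x.coord 0, -x.coord 1, -x.coord 2, -x.coord 3, -x.coord 4, -x.coord 5, -x.coord 6,
    -x.coord 7]⟩⟩

@[simp] theorem coord_add (x y : CayleyC) : (x + y).coord = x.coord + y.coord := rfl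

@[simp] theorem coord_zero : (0 : CayleyC).coord = 0 := rfl

@[simp] theorem coord_smul (c : ℂ) (x : CayleyC) : (c • x).coord = c • x.coord := rfl

theorem coord_mul (x y : CayleyC) : (x * y).coord = ![
    x.coord 0 * y.coord 0 - x.coord 1 * y.coord 1 - x.coord 2 * y.coord 2 - x.coord 3 * y.coord 3
      - x.coord 4 * y.coord 4 - x.coord 5 * y.coord 5 - x.coord 6 * y.coord 6 - x.coord 7 * y.coord 7,
    x.coord 0 * y.coord 1 + x.coord 1 * y.coord 0 + (x.coord 2 * y.coord 3 - x.coord 3 * y.coord 2)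
      + (x.coord 4 * y.coord 5 - x.coord 5 * y.coord 4) + (x.coord 6 * y.coord 7 - x.coord 7 * y.coord 6),
    x.coord 0 * y.coord 2 + x.coord 2 * y.coord 0 + (x.coord 3 * y.coord 1 - x.coord 1 * y.coord 3)
      + (x.coord 6 * y.coord 4 - x.coord 4 * y.coord 6) + (x.coord 5 * y.coord 7 - x.coord 7 * y.coord 5),
    x.coord 0 * y.coord 3 + x.coord 3 * y.coord 0 + (x.coord 1 * y.coord 2 - x.coord 2 * y.coord 1)
      + (x.coord 4 * y.coord 7 - x.coord 7 * y.coord 4) + (x.coord 5 * y.coord 6 - x.coord 6 * y.coord 5),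
    x.coord 0 * y.coord 4 + x.coord 4 * y.coord 0 + (x.coord 5 * y.coord 1 - x.coord 1 * y.coord 5)
      + (x.coord 2 * y.coord 6 - x.coord 6 * y.coord 2) + (x.coord 7 * y.coord 3 - x.coord 3 * y.coord 7),
    x.coord 0 * y.coord 5 + x.coord 5 * y.coord 0 + (x.coord 1 * y.coord 4 - x.coord 4 * y.coord 1)
      + (x.coord 7 * y.coord 2 - x.coord 2 * y.coord 7) + (x.coord 6 * y.coord 3 - x.coord 3 * y.coord 6),
    x.coord 0 * y.coord 6 + x.coord 6 * y.coord 0 + (x.coord 7 * y.coord 1 - x.coord 1 * y.coord 7)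
      + (x.coord 4 * y.coord 2 - x.coord 2 * y.coord 4) + (x.coord 3 * y.coord 5 - x.coord 5 * y.coord 3),
    x.coord 0 * y.coord 7 + x.coord 7 * y.coord 0 + (x.coord 1 * y.coord 6 - x.coord 6 * y.coord 1)
      + (x.coord 2 * y.coord 5 - x.coord 5 * y.coord 2) + (x.coord 3 * y.coord 4 - x.coord 4 * y.coord 3)] := rfl

theorem coord_star (x : CayleyC) : (star x).coord = ![x.coord 0, -x.coord 1, -x.coord 2,
    -x.coord 3, -x.coord 4, -x.coord 5, -x.coord 6, -x.coord 7] := rfl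

noncomputable instance : NonUnitalNonAssocRing CayleyC where
  left_distrib x y z := by
    ext k
    fin_cases k <;> simp [coord_mul] <;> ring
  right_distrib x y z := by
    ext k
    fin_cases k <;> simp [coord_mul] <;> ring
  zero_mul x := by
    ext k
    fin_cases k <;> simp [coord_mul]
  mul_zero x := by
    ext k
    fin_cases k <;> simp [coord_mul]

noncomputable instance : StarRing CayleyC where
  star_involutive x := by
    ext k
    fin_cases k <;> simp [coord_star]
  star_mul x y := by
    ext k
    fin_cases k <;> simp [coord_star, coord_mul] <;> ring
  star_add x y := by
    ext k
    fin_cases k <;> simp [coord_star] <;> ring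

theorem star_smul' (c : ℂ) (x : CayleyC) : star (c • x) = c • star x := by
  ext k
  fin_cases k <;> simp [coord_star]

theorem star_e0 : star (e 0) = e 0 := by
  ext k
  fin_cases k <;> simp [coord_star, e]

end CayleyC

/-! ### The exceptional complex Jordan algebra -/

/-- `𝔍^C = 𝔍(3, ℭ^C)`: the Hermitian `3 × 3` matrices over `ℭ^C`, i.e. those equal to the transpose
of their entrywise Cayley conjugate. -/
noncomputable def J : Submodule ℂ (Matrix (Fin 3) (Fin 3) CayleyC) where
  carrier := {X | Xᴴ = X}
  add_mem' {X Y} hX hY := by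
    simp only [Set.mem_ofPred_eq] at *
    rw [Matrix.conjTranspose_add, hX, hY]
  zero_mem' := Matrix.conjTranspose_zero
  smul_mem' c X hX := by
    simp only [Set.mem_ofPred_eq] at *
    ext i j : 1
    rw [Matrix.conjTranspose_apply, Matrix.smul_apply, Matrix.smul_apply, CayleyC.star_smul',
      ← Matrix.conjTranspose_apply, hX]

theorem mem_J {X : Matrix (Fin 3) (Fin 3) CayleyC} : X ∈ J ↔ Xᴴ = X := Iff.rfl

/-- The Jordan multiplication `X ∘ Y = (XY + YX) / 2`. -/
noncomputable def jordan (X Y : J) : J :=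
  ⟨(1 / 2 : ℂ) • (X.1 * Y.1 + Y.1 * X.1), J.smul_mem _ <| by
    have hX := mem_J.1 X.2
    have hY := mem_J.1 Y.2
    rw [mem_J, Matrix.conjTranspose_add, Matrix.conjTranspose_mul, Matrix.conjTranspose_mul, hX,
      hY, add_comm]⟩

/-- The diagonal idempotents: `E 0`, `E 1`, `E 2` are `E₁`, `E₂`, `E₃`. -/
noncomputable def E (i : Fin 3) : J :=
  ⟨Matrix.diagonal (Pi.single i (CayleyC.e 0)), by
    rw [mem_J, Matrix.diagonal_conjTranspose]
    congr 1
    funext j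
    rcases eq_or_ne j i with rfl | h
    · rw [Pi.star_apply, Pi.single_eq_same, CayleyC.star_e0]
    · simp [h]⟩

/-- `F₁(x)`: the matrix with `x` in position `(2,3)`, its conjugate in position `(3,2)`, and zeros
elsewhere. -/
noncomputable def F1 (x : CayleyC) : J :=
  ⟨!![0, 0, 0; 0, 0, x; 0, star x, 0], by
    rw [mem_J]
    ext i j : 1
    fin_cases i <;> fin_cases j <;> simp [Matrix.conjTranspose_apply]⟩

/-! ### The group `F₄^C` and the stabilizer -/

/-- `F₄^C`: the group of `ℂ`-linear automorphisms of the exceptional Jordan algebra. -/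
noncomputable def F4 : Subgroup (J ≃ₗ[ℂ] J) where
  carrier := {α | ∀ X Y : J, α (jordan X Y) = jordan (α X) (α Y)}
  mul_mem' {α β} hα hβ X Y := by
    simp only [Set.mem_ofPred_eq] at hα hβ
    rw [LinearEquiv.mul_apply, LinearEquiv.mul_apply, LinearEquiv.mul_apply, hβ, hα]
  one_mem' _ _ := rfl
  inv_mem' {α} hα X Y := by
    simp only [Set.mem_ofPred_eq] at hα
    change α.symm _ = jordan (α.symm X) (α.symm Y)
    rw [LinearEquiv.symm_apply_eq, hα, α.apply_symm_apply, α.apply_symm_apply]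

/-- The stabilizer of `E₁, E₂, E₃, F₁(e₀), F₁(e₁)` in `F₄^C`. -/
noncomputable def stab : Subgroup F4 where
  carrier := {α | (∀ i, α.1 (E i) = E i) ∧ α.1 (F1 (CayleyC.e 0)) = F1 (CayleyC.e 0) ∧
    α.1 (F1 (CayleyC.e 1)) = F1 (CayleyC.e 1)}
  mul_mem' {α β} hα hβ := by
    obtain ⟨h1, h2, h3⟩ := hα
    obtain ⟨k1, k2, k3⟩ := hβ
    refine ⟨fun i => ?_, ?_, ?_⟩ <;>
      simp only [Subgroup.coe_mul, LinearEquiv.mul_apply, h1, h2, h3, k1, k2, k3]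
  one_mem' := ⟨fun _ => rfl, rfl, rfl⟩
  inv_mem' {α} hα := by
    obtain ⟨h1, h2, h3⟩ := hα
    refine ⟨fun i => ?_, ?_, ?_⟩
    · exact (LinearEquiv.symm_apply_eq α.1).2 (h1 i).symm
    · exact (LinearEquiv.symm_apply_eq α.1).2 h2.symm
    · exact (LinearEquiv.symm_apply_eq α.1).2 h3.symm

/-- The standard quadratic form `z₁² + ⋯ + zₙ²` on `ℂⁿ`. -/
noncomputable def stdForm (n : ℕ) : QuadraticForm ℂ (Fin n → ℂ) :=
  QuadraticMap.weightedSumSquares ℂ (fun _ : Fin n => (1 : ℂ))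

/-- `Spin(n, ℂ)`, realized in the Clifford algebra of the standard quadratic form on `ℂⁿ`. -/
noncomputable abbrev Spin (n : ℕ) : Submonoid (CliffordAlgebra (stdForm n)) :=
  spinGroup (stdForm n)

/-! ### Holomorphic maps between linear groups -/

section Holomorphic

variable {A B V W : Type*} [AddCommGroup V] [Module ℂ V] [AddCommGroup W] [Module ℂ W]

/-- Let `A` and `B` be realized inside the finite-dimensional complex vector spaces `V` and `W`
through `i : A → V` and `j : B → W`. A map `f : A → B` is holomorphic if around every point of `A`
it is the restriction of a holomorphic map from an open subset of `V` to `W` (in linear coordinates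
on `V` and `W`; the choice of coordinates is immaterial). For closed complex submanifolds `A` and
`B`, such as linear complex Lie groups, this is holomorphy for the submanifold structures. -/
def IsHolomorphic (i : A → V) (j : B → W) (f : A → B) : Prop :=
  ∃ (n m : ℕ) (v : V ≃ₗ[ℂ] (Fin n → ℂ)) (w : W ≃ₗ[ℂ] (Fin m → ℂ)),
    ∀ a : A, ∃ (U : Set (Fin n → ℂ)) (g : (Fin n → ℂ) → (Fin m → ℂ)),
      IsOpen U ∧ v (i a) ∈ U ∧ DifferentiableOn ℂ g U ∧
        ∀ b : A, v (i b) ∈ U → w (j (f b)) = g (v (i b))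

end Holomorphic

/-- The inclusion of the stabilizer in the space of `ℂ`-linear endomorphisms of `𝔍^C`. -/
noncomputable def stabToEnd (α : stab) : Module.End ℂ J := (α.1.1 : J →ₗ[ℂ] J)

/-- The inclusion of `Spin(n, ℂ)` in the Clifford algebra. -/
noncomputable def spinToClifford (n : ℕ) (s : Spin n) : CliffordAlgebra (stdForm n) := s.1

end F4C

/-! An automorphism fixing `E₁, E₂, E₃` preserves the three off-diagonal Peirce spaces, so it is a
triple `(a, b, c)` of maps of `ℭ^C`. The Jordan product makes `a` and `b` orthogonal and gives `star
(a x * b y) = c (star (x * y))`. Fixing `F₁(e₀)` means `a e₀ = e₀`; this forces `c` to be `b`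
conjugated by the Cayley conjugation and leaves the single relation `a x * b y = b (x * y)`. Putting
`b y = e₀` there recovers `a` from `b`, so the triple is determined by `b` alone.

Left multiplications by the span of `e₂, …, e₇`, scaled by `√-1`, satisfy the Clifford relations,
and a dimension count makes `rho : Cl(6) → End(ℭ^C)` an isomorphism (`rho_bijective`). Hence `b =
rho s` for a unique `s`. Orthogonality of `b` says `star s * s = 1`. The condition `a e₁ = e₁` says
that `b` commutes with left multiplication by `e₁`, which implements the grading involution, so `s`
is even (`mem_even_iff`). Finally `a` preserves the orthogonal complement of `e₀, e₁`, so
conjugation by `s` preserves vectors. By a Cartan–Dieudonné argument (`mem_lipschitz`) such an `s`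
is a product of invertible vectors, hence lies in the spin group.

Conversely, a spin element `s` gives `b = rho s` and `a x = b (x * b⁻¹ e₀)`, and triality
(`isTriality_of_mul`) turns these into an automorphism. The map `α ↦ s` is the restriction of a
linear map and its inverse that of a polynomial of degree two, because `b⁻¹ = rho (star s)`; both
are therefore holomorphic. -/

namespace F4C

/-! ### Composition-algebra identities in `ℭ^C`. -/

namespace CayleyC

/-- The linear identification of `ℭ^C` with `ℂ⁸`. -/
noncomputable def coordL : CayleyC ≃ₗ[ℂ] (Fin 8 → ℂ) where
  __ := coordEquiv
  map_add' _ _ := rfl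
  map_smul' _ _ := rfl

@[simp] theorem coordL_apply (x : CayleyC) : coordL x = x.coord := rfl

@[simp] theorem coordL_symm_apply (v : Fin 8 → ℂ) : coordL.symm v = ⟨v⟩ := rfl

@[simp] theorem coord_neg (x : CayleyC) : (-x).coord = -x.coord := rfl

@[simp] theorem coord_sub (x y : CayleyC) : (x - y).coord = x.coord - y.coord := rfl

instance : Module.Finite ℂ CayleyC := Module.Finite.equiv coordL.symm

theorem finrank_cayleyC : Module.finrank ℂ CayleyC = 8 := by
  simp [coordL.finrank_eq]

instance : IsScalarTower ℂ CayleyC CayleyC where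
  smul_assoc c x y := by
    ext k
    fin_cases k <;> simp [coord_mul] <;> ring

instance : SMulCommClass ℂ CayleyC CayleyC where
  smul_comm c x y := by
    ext k
    fin_cases k <;> simp [coord_mul] <;> ring

theorem e0_mul (x : CayleyC) : e 0 * x = x := by
  ext k
  fin_cases k <;> simp [coord_mul, e]

theorem mul_e0 (x : CayleyC) : x * e 0 = x := by
  ext k
  fin_cases k <;> simp [coord_mul, e]

/-- Left multiplication by an element of `ℭ^C`. -/
noncomputable def L : CayleyC →ₗ[ℂ] Module.End ℂ CayleyC := LinearMap.mul ℂ CayleyC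

@[simp] theorem L_apply (x y : CayleyC) : L x y = x * y := rfl

/-- Conjugation as a linear map. -/
noncomputable def conjL : CayleyC →ₗ[ℂ] CayleyC where
  toFun := star
  map_add' := star_add
  map_smul' := star_smul'

@[simp] theorem conjL_apply (x : CayleyC) : conjL x = star x := rfl

/-- The standard symmetric bilinear form on `ℭ^C`. -/
noncomputable def ip (x y : CayleyC) : ℂ := ∑ k, x.coord k * y.coord k

theorem ip_comm (x y : CayleyC) : ip x y = ip y x := by
  simp [ip, mul_comm]

theorem ip_add_left (x y z : CayleyC) : ip (x + y) z = ip x z + ip y z := by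
  simp [ip, add_mul, Finset.sum_add_distrib]

theorem ip_add_right (x y z : CayleyC) : ip x (y + z) = ip x y + ip x z := by
  simp [ip, mul_add, Finset.sum_add_distrib]

theorem ip_smul_left (c : ℂ) (x y : CayleyC) : ip (c • x) y = c * ip x y := by
  simp [ip, mul_assoc, Finset.mul_sum]

theorem ip_smul_right (c : ℂ) (x y : CayleyC) : ip x (c • y) = c * ip x y := by
  rw [ip_comm, ip_smul_left, ip_comm]

theorem ip_e (x : CayleyC) (k : Fin 8) : ip x (e k) = x.coord k := by
  simp [ip, e, Pi.single_apply]

theorem ext_ip {x y : CayleyC} (h : ∀ z, ip x z = ip y z) : x = y := by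
  ext k
  simpa [ip_e] using h (e k)

theorem ip_star_star (x y : CayleyC) : ip (star x) (star y) = ip x y := by
  simp [ip, Fin.sum_univ_eight, coord_star]

/-- Left multiplication by `star x` is adjoint to left multiplication by `x`. -/
theorem ip_mul_left (x y z : CayleyC) : ip (x * y) z = ip y (star x * z) := by
  simp [ip, Fin.sum_univ_eight, coord_star, coord_mul]
  ring

/-- Both sides are `e₀`-coordinates of triple products. This cyclic symmetry of the trilinear form
is what drives triality. -/
theorem ip_mul_star_cyclic (x y z : CayleyC) : ip (x * y) (star z) = ip (y * z) (star x) := by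
  simp [ip, Fin.sum_univ_eight, coord_star, coord_mul]
  ring

theorem star_mul_mul (x y : CayleyC) : star x * (x * y) = ip x x • y := by
  ext k
  fin_cases k <;> simp [ip, Fin.sum_univ_eight, coord_star, coord_mul] <;> ring

theorem ip_mul_mul_right (x y z : CayleyC) : ip (x * z) (y * z) = ip x y * ip z z := by
  simp [ip, Fin.sum_univ_eight, coord_mul]
  ring

/-- The inclusion of `ℂ⁶` in `ℭ^C` as the span of `e₂, …, e₇`. -/
noncomputable def inc : (Fin 6 → ℂ) →ₗ[ℂ] CayleyC where
  toFun v := ⟨![0, 0, v 0, v 1, v 2, v 3, v 4, v 5]⟩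
  map_add' v w := by
    ext k
    fin_cases k <;> simp
  map_smul' c v := by
    ext k
    fin_cases k <;> simp

theorem coord_inc (v : Fin 6 → ℂ) :
    (inc v).coord = ![0, 0, v 0, v 1, v 2, v 3, v 4, v 5] := rfl

theorem eq_add_inc (x : CayleyC) : x = x.coord 0 • e 0 + x.coord 1 • e 1 +
    inc ![x.coord 2, x.coord 3, x.coord 4, x.coord 5, x.coord 6, x.coord 7] := by
  ext k
  fin_cases k <;> simp [coord_inc, e]

/-- Linearized alternativity for orthogonal imaginary elements. It makes left multiplication by `e₁`
anticommute with every Clifford generator. -/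
theorem e1_mul_inc_mul (v : Fin 6 → ℂ) (y : CayleyC) :
    e 1 * (inc v * y) = -(inc v * (e 1 * y)) := by
  ext k
  fin_cases k <;> simp [coord_inc, coord_mul, e] <;> ring

theorem e1_mul_e1_mul (y : CayleyC) : e 1 * (e 1 * y) = -y := by
  ext k
  fin_cases k <;> simp [coord_mul, e]

theorem star_inc (v : Fin 6 → ℂ) : star (inc v) = -inc v := by
  ext k
  fin_cases k <;> simp [coord_inc, coord_star]

theorem stdForm_eq (v : Fin 6 → ℂ) : stdForm 6 v = ip (inc v) (inc v) := by
  simp [stdForm, ip, Fin.sum_univ_eight, Fin.sum_univ_six, coord_inc,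
    QuadraticMap.weightedSumSquares_apply]

/-- The Clifford relation with the wrong sign; the factor `√-1` in `rho` corrects it. -/
theorem inc_mul_inc_mul (v : Fin 6 → ℂ) (y : CayleyC) :
    inc v * (inc v * y) = -(stdForm 6 v • y) := by
  rw [stdForm_eq, ← star_mul_mul, star_inc, neg_mul, neg_neg]

end CayleyC

/-! ### The spin representation is an isomorphism onto `End(ℭ^C)`. -/

open CayleyC CliffordAlgebra

/-- The spin representation of the Clifford algebra of `ℂ⁶` on `ℭ^C`: a vector acts by
`√-1` times left multiplication. -/
noncomputable def rho : CliffordAlgebra (stdForm 6) →ₐ[ℂ] Module.End ℂ CayleyC :=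
  CliffordAlgebra.lift (stdForm 6) ⟨Complex.I • (L ∘ₗ inc), fun v => by
    ext1 y
    simp only [LinearMap.smul_apply, LinearMap.comp_apply, Module.End.mul_apply, L_apply,
      Module.algebraMap_end_apply, mul_smul_comm, inc_mul_inc_mul, smul_smul, Complex.I_mul_I]
    simp⟩

theorem rho_ι (v : Fin 6 → ℂ) : rho (ι (stdForm 6) v) = Complex.I • L (inc v) := by
  simp [rho]

theorem rho_ι_apply (v : Fin 6 → ℂ) (y : CayleyC) :
    rho (ι (stdForm 6) v) y = Complex.I • (inc v * y) := by
  simp [rho_ι]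

theorem L_inc_mem_range (v : Fin 6 → ℂ) : L (inc v) ∈ rho.range :=
  ⟨ι (stdForm 6) (-Complex.I • v), by
    simp [rho_ι, smul_smul]⟩

theorem inc_single (k : Fin 6) : inc (Pi.single k 1) = e (k.natAdd 2) := by
  ext j
  fin_cases k <;> fin_cases j <;> simp [coord_inc, e]

theorem L_e_mem_range {a : Fin 8} (ha : 2 ≤ a) : L (e a) ∈ rho.range := by
  obtain ⟨k, rfl⟩ : ∃ k : Fin 6, a = k.natAdd 2 :=
    ⟨⟨a - 2, by omega⟩, by ext; simp; omega⟩
  rw [← inc_single]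
  exact L_inc_mem_range _

/-- This and the next two operators are commuting diagonal involutions in the image of `rho`. Their
`-1` eigenspaces have only the line of `e₀` in common. -/
theorem coord_e2_e5_e7 (y : CayleyC) : (e 2 * (e 5 * (e 7 * y))).coord =
    ![-y.coord 0, y.coord 1, -y.coord 2, y.coord 3, y.coord 4, -y.coord 5, y.coord 6,
      -y.coord 7] := by
  ext k
  fin_cases k <;> simp [coord_mul, e]

theorem coord_e2_e6_e4 (y : CayleyC) : (e 2 * (e 6 * (e 4 * y))).coord =
    ![-y.coord 0, y.coord 1, -y.coord 2, y.coord 3, -y.coord 4, y.coord 5, -y.coord 6,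
      y.coord 7] := by
  ext k
  fin_cases k <;> simp [coord_mul, e]

theorem coord_e3_e4_e7 (y : CayleyC) : (e 3 * (e 4 * (e 7 * y))).coord =
    ![-y.coord 0, y.coord 1, y.coord 2, -y.coord 3, -y.coord 4, y.coord 5, y.coord 6,
      -y.coord 7] := by
  ext k
  fin_cases k <;> simp [coord_mul, e]

theorem one_sub_L_mul_mem_range {a b c : Fin 8} (ha : 2 ≤ a) (hb : 2 ≤ b) (hc : 2 ≤ c) :
    1 - L (e a) * (L (e b) * L (e c)) ∈ rho.range :=
  sub_mem (one_mem _) (mul_mem (L_e_mem_range ha) (mul_mem (L_e_mem_range hb) (L_e_mem_range hc)))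

/-- The projection to the line of `e₀` lies in the image of the spin representation. -/
theorem exists_projection : ∃ P ∈ rho.range, ∀ y, P y = y.coord 0 • e 0 := by
  obtain ⟨A, hA, hAy⟩ : ∃ A ∈ rho.range, ∀ y, A y = y - e 2 * (e 5 * (e 7 * y)) :=
    ⟨_, one_sub_L_mul_mem_range (a := 2) (b := 5) (c := 7) (by decide) (by decide) (by decide),
      fun y => by simp⟩
  obtain ⟨B, hB, hBy⟩ : ∃ B ∈ rho.range, ∀ y, B y = y - e 2 * (e 6 * (e 4 * y)) :=
    ⟨_, one_sub_L_mul_mem_range (a := 2) (b := 6) (c := 4) (by decide) (by decide) (by decide),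
      fun y => by simp⟩
  obtain ⟨C, hC, hCy⟩ : ∃ C ∈ rho.range, ∀ y, C y = y - e 3 * (e 4 * (e 7 * y)) :=
    ⟨_, one_sub_L_mul_mem_range (a := 3) (b := 4) (c := 7) (by decide) (by decide) (by decide),
      fun y => by simp⟩
  -- Each of the three factors is `2` on the `-1` eigenspace of its involution and `0` on the `+1`
  -- eigenspace, so the product is `8` times the projection.
  refine ⟨(1 / 8 : ℂ) • (A * (B * C)),
    Subalgebra.smul_mem _ (mul_mem hA (mul_mem hB hC)) _, fun y => ?_⟩
  have h : (A (B (C y))).coord = Pi.single 0 (8 * y.coord 0) := by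
    rw [hAy, coord_sub, coord_e2_e5_e7, hBy, coord_sub, coord_e2_e6_e4, hCy, coord_sub,
      coord_e3_e4_e7]
    ext k
    fin_cases k <;> simp [Matrix.vecHead, Matrix.vecTail]
    all_goals ring
  ext1
  simp only [LinearMap.smul_apply, Module.End.mul_apply, coord_smul, h, e]
  ext k
  by_cases hk : k = 0 <;> simp [hk]

theorem exists_apply_e0 (x : CayleyC) : ∃ u ∈ rho.range, u (e 0) = x := by
  -- The direction `e₁` is not among the generators; it is reached through `e₂ e₃ = e₁`.
  refine ⟨x.coord 0 • 1 + x.coord 1 • (L (e 2) * L (e 3)) +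
    L (inc ![x.coord 2, x.coord 3, x.coord 4, x.coord 5, x.coord 6, x.coord 7]),
    add_mem (add_mem (Subalgebra.smul_mem _ (one_mem _) _) (Subalgebra.smul_mem _
      (mul_mem (L_e_mem_range (by decide)) (L_e_mem_range (by decide))) _)) (L_inc_mem_range _), ?_⟩
  have h : e 2 * e 3 = e 1 := by
    ext k
    fin_cases k <;> simp [coord_mul, e]
  conv_rhs => rw [eq_add_inc x]
  simp [mul_e0, h]

theorem exists_coord (b : Fin 8) : ∃ w ∈ rho.range, ∀ y, (w y).coord 0 = y.coord b := by
  by_cases h0 : b = 0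
  · exact ⟨1, one_mem _, fun y => by simp [h0]⟩
  by_cases h1 : b = 1
  · refine ⟨L (e 3) * L (e 2), mul_mem (L_e_mem_range (by decide)) (L_e_mem_range (by decide)), fun y => ?_⟩
    subst h1
    simp [coord_mul, e]
  obtain ⟨k, rfl⟩ : ∃ k : Fin 6, b = k.natAdd 2 :=
    ⟨⟨b - 2, by omega⟩, by ext; simp; omega⟩
  refine ⟨-L (e (k.natAdd 2)), neg_mem (L_e_mem_range (by simp [Fin.le_def])), fun y => ?_⟩
  rw [← inc_single]
  fin_cases k <;> simp [coord_mul, coord_inc]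

/-- The projection to `e₀`, multiplied on the left by operators carrying `e₀` anywhere and on the
right by operators moving any coordinate to position `0`, produces all rank-one maps. -/
theorem rho_surjective : Function.Surjective rho := by
  intro T
  obtain ⟨P, hP, hPy⟩ := exists_projection
  choose u hu hue using exists_apply_e0
  choose w hw hwy using exists_coord
  suffices h : T = ∑ b, u (T (e b)) * (P * w b) by
    rw [h]
    exact (sum_mem fun b _ => mul_mem (hu _) (mul_mem hP (hw _)) : _ ∈ rho.range)
  ext1 y
  have hy : y = ∑ b, y.coord b • e b := by
    apply coordL.injective
    ext k
    simp [e, Pi.single_apply]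
  conv_lhs => rw [hy]
  simp [LinearMap.sum_apply, hPy, hwy, hue]

theorem finrank_cliffordAlgebra : Module.finrank ℂ (CliffordAlgebra (stdForm 6)) = 64 := by
  rw [(equivExterior (stdForm 6)).finrank_eq,
    Module.finrank_eq_card_basis (Pi.basisFun ℂ (Fin 6)).ExteriorAlgebra]
  simp

instance : Module.Finite ℂ (CliffordAlgebra (stdForm 6)) :=
  Module.finite_of_finrank_pos (by simp [finrank_cliffordAlgebra])

/-- A surjection between spaces of equal dimension: `2⁶ = 8²`. -/
theorem rho_bijective : Function.Bijective rho := by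
  refine ⟨?_, rho_surjective⟩
  refine (LinearMap.injective_iff_surjective_of_finrank_eq_finrank (f := rho.toLinearMap)
    ?_).2 rho_surjective
  rw [finrank_cliffordAlgebra, Module.finrank_linearMap, finrank_cayleyC]

/-- The spin representation identifies the Clifford algebra of `ℂ⁶` with `End(ℭ^C)`. -/
noncomputable def rhoEquiv : CliffordAlgebra (stdForm 6) ≃ₐ[ℂ] Module.End ℂ CayleyC :=
  AlgEquiv.ofBijective rho rho_bijective

@[simp] theorem rho_rhoEquiv_symm (g : Module.End ℂ CayleyC) : rho (rhoEquiv.symm g) = g :=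
  rhoEquiv.apply_symm_apply g

/-! ### Adjoints, parity and the centre of the Clifford algebra, read off from `rho`. -/

/-- The Clifford conjugate acts by the adjoint. -/
theorem ip_rho (s : CliffordAlgebra (stdForm 6)) :
    ∀ x y, ip (rho s x) y = ip x (rho (star s) y) := by
  induction s using CliffordAlgebra.induction with
  | algebraMap r =>
    intro x y
    simp [star_algebraMap, ip_smul_left, ip_smul_right]
  | ι v =>
    intro x y
    simp only [star_ι, map_neg, rho_ι, LinearMap.neg_apply, LinearMap.smul_apply, L_apply,
      ip_smul_left, ip_mul_left, star_inc, neg_mul, ← smul_neg, ip_smul_right]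
  | mul a b ha hb =>
    intro x y
    simp [ha, hb]
  | add a b ha hb =>
    intro x y
    simp [ha, hb, ip_add_left, ip_add_right]

/-- Left multiplication by `e₁` anticommutes with the generators, so conjugation by it is the
grading involution; it plays the role of the volume element. -/
theorem rho_involute_mul (s : CliffordAlgebra (stdForm 6)) :
    rho (involute s) * L (e 1) = L (e 1) * rho s := by
  induction s using CliffordAlgebra.induction with
  | algebraMap r =>
    rw [AlgHom.commutes, AlgHom.commutes, Algebra.commutes]
  | ι v =>
    ext1 y
    simp [rho_ι, e1_mul_inc_mul]
  | mul a b ha hb =>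
    rw [map_mul, map_mul, mul_assoc, hb, ← mul_assoc, ha, map_mul, mul_assoc]
  | add a b ha hb =>
    rw [map_add, map_add, add_mul, ha, hb, map_add, mul_add]

theorem mem_even_of_involute_eq {s : CliffordAlgebra (stdForm 6)} (h : involute s = s) :
    s ∈ even (stdForm 6) := by
  have hs : s ∈ evenOdd (stdForm 6) 0 ⊔ evenOdd (stdForm 6) 1 := by
    rw [(evenOdd_isCompl (stdForm 6)).sup_eq_top]
    trivial
  obtain ⟨a, ha, b, hb, rfl⟩ := Submodule.mem_sup.1 hs
  rw [map_add, involute_eq_of_mem_even ha, involute_eq_of_mem_odd hb] at h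
  have hb0 : b = 0 := by
    have h2 : (2 : ℂ) • b = 0 := by
      rw [two_smul]
      nth_rw 1 [← add_left_cancel h]
      exact neg_add_cancel b
    exact (smul_eq_zero.1 h2).resolve_left two_ne_zero
  rw [hb0, add_zero]
  exact ha

/-- The even part of the Clifford algebra is the centralizer of left multiplication by `e₁`. -/
theorem mem_even_iff (s : CliffordAlgebra (stdForm 6)) :
    s ∈ even (stdForm 6) ↔ ∀ y, rho s (e 1 * y) = e 1 * rho s y := by
  constructor
  · intro hs y
    have h := rho_involute_mul s
    rw [involute_eq_of_mem_even hs] at h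
    exact LinearMap.congr_fun h y
  · intro h
    apply mem_even_of_involute_eq
    apply rho_bijective.1
    ext1 y
    have h1 := LinearMap.congr_fun (rho_involute_mul s) (-(e 1 * y))
    simp only [Module.End.mul_apply, L_apply, map_neg, h, e1_mul_e1_mul, neg_neg] at h1
    exact h1

/-- Through `rho` the Clifford algebra is a full endomorphism algebra, whose centre consists of
scalars. -/
theorem exists_eq_algebraMap_of_commute {s : CliffordAlgebra (stdForm 6)}
    (h : ∀ t, Commute s t) : ∃ c, s = algebraMap ℂ _ c := by
  have hc : rho s ∈ Subalgebra.center ℂ (Module.End ℂ CayleyC) := by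
    rw [Subalgebra.mem_center_iff]
    intro g
    obtain ⟨t, rfl⟩ := rho_surjective g
    rw [← map_mul, ← map_mul, (h t).eq]
  obtain ⟨c, hc⟩ := Algebra.mem_bot.1 ((Algebra.IsCentral.center_eq_bot ℂ _).le hc)
  exact ⟨c, rho_bijective.1 (by rw [← hc, AlgHom.commutes])⟩

/-! ### The even Clifford group is generated by vectors (Cartan–Dieudonné). -/

theorem stdForm_apply (n : ℕ) (v : Fin n → ℂ) : stdForm n v = ∑ i, v i * v i := by
  simp [stdForm, QuadraticMap.weightedSumSquares_apply]

theorem polar_stdForm_single (n : ℕ) (v : Fin n → ℂ) (k : Fin n) :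
    QuadraticMap.polar (stdForm n) v (Pi.single k 1) = 2 * v k := by
  have h : ∀ i, (v i + (Pi.single k 1 : Fin n → ℂ) i) * (v i + (Pi.single k 1 : Fin n → ℂ) i) =
      v i * v i + (Pi.single k 1 : Fin n → ℂ) i * (Pi.single k 1 : Fin n → ℂ) i +
        2 * (v i * (Pi.single k 1 : Fin n → ℂ) i) := fun i => by ring
  simp only [QuadraticMap.polar, stdForm_apply, Pi.add_apply, h, Finset.sum_add_distrib,
    ← Finset.mul_sum]
  simp [Pi.single_apply]
  ring

theorem stdForm_single (n : ℕ) (k : Fin n) : stdForm n (Pi.single k 1) = 1 := by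
  simp [stdForm_apply, Pi.single_apply]

theorem stdForm_add_single (n : ℕ) (v : Fin n → ℂ) (k : Fin n) :
    stdForm n (v + Pi.single k 1) = stdForm n v + 1 + 2 * v k := by
  rw [QuadraticMap.map_add (stdForm n), stdForm_single, polar_stdForm_single]

theorem stdForm_sub_single (n : ℕ) (v : Fin n → ℂ) (k : Fin n) :
    stdForm n (v - Pi.single k 1) = stdForm n v + 1 - 2 * v k := by
  rw [sub_eq_add_neg, QuadraticMap.map_add (stdForm n), QuadraticMap.map_neg, stdForm_single,
    QuadraticMap.polar_neg_right, polar_stdForm_single]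
  ring

variable {n : ℕ}

theorem ι_sq_std (v : Fin n → ℂ) :
    ι (stdForm n) v * ι (stdForm n) v = stdForm n v • 1 := by
  rw [ι_sq_scalar, Algebra.algebraMap_eq_smul_one]

theorem ι_mul_single_add (v : Fin n → ℂ) (k : Fin n) :
    ι (stdForm n) v * ι (stdForm n) (Pi.single k 1) +
      ι (stdForm n) (Pi.single k 1) * ι (stdForm n) v = (2 * v k) • 1 := by
  rw [ι_mul_ι_add_swap, polar_stdForm_single, Algebra.algebraMap_eq_smul_one]

theorem ι_single_mul_self (k : Fin n) :
    ι (stdForm n) (Pi.single k 1) * ι (stdForm n) (Pi.single k 1) = 1 := by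
  rw [ι_sq_std, stdForm_single, one_smul]

theorem ι_mul_single_comm {v : Fin n → ℂ} {k : Fin n} (h : v k = 0) :
    ι (stdForm n) v * ι (stdForm n) (Pi.single k 1) =
      -(ι (stdForm n) (Pi.single k 1) * ι (stdForm n) v) := by
  rw [eq_neg_iff_add_eq_zero, ι_mul_single_add, h, mul_zero, zero_smul]

/-- Elements of the Clifford algebra that normalize the space of vectors. -/
def PreservesVectors (s : CliffordAlgebra (stdForm n)) : Prop :=
  ∀ v, ∃ v', s * ι (stdForm n) v = ι (stdForm n) v' * s

theorem PreservesVectors.mul {s t : CliffordAlgebra (stdForm n)} (hs : PreservesVectors s)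
    (ht : PreservesVectors t) : PreservesVectors (s * t) := by
  intro v
  obtain ⟨w, hw⟩ := ht v
  obtain ⟨x, hx⟩ := hs w
  exact ⟨x, by rw [mul_assoc, hw, ← mul_assoc, hx, mul_assoc]⟩

/-- Conjugation by `a` is minus the reflection in the hyperplane orthogonal to `a`. -/
theorem preservesVectors_ι {a : Fin n → ℂ} (ha : stdForm n a ≠ 0) :
    PreservesVectors (ι (stdForm n) a) := by
  intro v
  refine ⟨(QuadraticMap.polar (stdForm n) a v / stdForm n a) • a - v, ?_⟩
  rw [map_sub, map_smul, sub_mul, smul_mul_assoc, ι_sq_std, smul_smul, div_mul_cancel₀ _ ha,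
    eq_sub_iff_add_eq, ι_mul_ι_add_swap, Algebra.algebraMap_eq_smul_one]

theorem exists_lipschitz_ι {a : Fin n → ℂ} (ha : stdForm n a ≠ 0) :
    ∃ u ∈ lipschitzGroup (stdForm n), (u : CliffordAlgebra (stdForm n)) = ι (stdForm n) a := by
  obtain ⟨u, hu⟩ := isUnit_ι_of_isUnit (Q := stdForm n) ha.isUnit
  exact ⟨u, Subgroup.subset_closure ⟨a, hu.symm⟩, hu⟩

theorem exists_lipschitz_ι_mul_ι {a b : Fin n → ℂ} (ha : stdForm n a ≠ 0)
    (hb : stdForm n b ≠ 0) :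
    ∃ u ∈ lipschitzGroup (stdForm n),
      (u : CliffordAlgebra (stdForm n)) = ι (stdForm n) a * ι (stdForm n) b ∧
      (u : CliffordAlgebra (stdForm n)) ∈ even (stdForm n) ∧
      PreservesVectors (u : CliffordAlgebra (stdForm n)) := by
  obtain ⟨u, hu, hua⟩ := exists_lipschitz_ι ha
  obtain ⟨w, hw, hwb⟩ := exists_lipschitz_ι hb
  have h : ((u * w : (CliffordAlgebra (stdForm n))ˣ) : CliffordAlgebra (stdForm n)) =
      ι (stdForm n) a * ι (stdForm n) b := by rw [Units.val_mul, hua, hwb]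
  refine ⟨u * w, mul_mem hu hw, h, ?_, ?_⟩
  · rw [h]
    exact ι_mul_ι_mem_evenOdd_zero (stdForm n) a b
  · rw [h]
    exact (preservesVectors_ι ha).mul (preservesVectors_ι hb)

/-- The image `f` of a basis vector under an element of the Clifford group has norm one. -/
theorem stdForm_image {s : (CliffordAlgebra (stdForm n))ˣ} {f : Fin n → ℂ} {k : Fin n}
    (hf : s * ι (stdForm n) (Pi.single k 1) = ι (stdForm n) f * s) : stdForm n f = 1 := by
  have h : (1 : ℂ) • (s : CliffordAlgebra (stdForm n)) = stdForm n f • s := by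
    calc (1 : ℂ) • (s : CliffordAlgebra (stdForm n))
        = s * (ι (stdForm n) (Pi.single k 1) * ι (stdForm n) (Pi.single k 1)) := by
          rw [ι_single_mul_self, mul_one, one_smul]
      _ = stdForm n f • s := by
          rw [← mul_assoc, hf, mul_assoc, hf, ← mul_assoc, ι_sq_std, smul_one_mul]
  exact (smul_left_injective ℂ s.ne_zero h).symm

/-- The image `f` of a basis vector is orthogonal to the other fixed basis vectors. -/
theorem image_apply_eq_zero {s : (CliffordAlgebra (stdForm n))ˣ} {f : Fin n → ℂ} {k j : Fin n}
    (hf : s * ι (stdForm n) (Pi.single k 1) = ι (stdForm n) f * s)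
    (hj : s * ι (stdForm n) (Pi.single j 1) = ι (stdForm n) (Pi.single j 1) * s) (hjk : j ≠ k) :
    f j = 0 := by
  have h : (2 * f j) • (s : CliffordAlgebra (stdForm n)) = (0 : ℂ) • s := by
    calc (2 * f j) • (s : CliffordAlgebra (stdForm n))
        = (ι (stdForm n) f * ι (stdForm n) (Pi.single j 1) +
            ι (stdForm n) (Pi.single j 1) * ι (stdForm n) f) * s := by
          rw [ι_mul_single_add, smul_one_mul]
      _ = s * (ι (stdForm n) (Pi.single k 1) * ι (stdForm n) (Pi.single j 1) +
            ι (stdForm n) (Pi.single j 1) * ι (stdForm n) (Pi.single k 1)) := by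
          rw [add_mul, mul_assoc, ← hj, ← mul_assoc, ← hf,
            mul_assoc (ι (stdForm n) (Pi.single j 1)), ← hf, ← mul_assoc (ι (stdForm n) _), ← hj,
            mul_add, mul_assoc, mul_assoc]
      _ = (0 : ℂ) • s := by
          rw [ι_mul_single_add, Pi.single_eq_of_ne hjk, mul_zero, zero_smul, mul_zero, zero_smul]
  simpa using smul_left_injective ℂ s.ne_zero h

/-- One step of the Cartan–Dieudonné reduction: an element of the even Clifford group fixing the
basis vectors before `e k` can be corrected by an even product of vectors so as to also fix
`e k`. -/
theorem exists_lipschitz_fix {k l : Fin n} (hkl : k < l) {s : (CliffordAlgebra (stdForm n))ˣ}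
    (hs : PreservesVectors (s : CliffordAlgebra (stdForm n)))
    (hfix : ∀ j < k, s * ι (stdForm n) (Pi.single j 1) = ι (stdForm n) (Pi.single j 1) * s) :
    ∃ u ∈ lipschitzGroup (stdForm n), (u : CliffordAlgebra (stdForm n)) ∈ even (stdForm n) ∧
      PreservesVectors (u : CliffordAlgebra (stdForm n)) ∧
      ∀ j ≤ k, (u * s : CliffordAlgebra (stdForm n)) * ι (stdForm n) (Pi.single j 1) =
        ι (stdForm n) (Pi.single j 1) * (u * s) := by
  obtain ⟨f, hf⟩ := hs (Pi.single k 1)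
  have hQ := stdForm_image hf
  have hfj : ∀ j < k, f j = 0 := fun j hj => image_apply_eq_zero hf (hfix j hj) hj.ne
  suffices h : ∃ u ∈ lipschitzGroup (stdForm n),
      (u : CliffordAlgebra (stdForm n)) ∈ even (stdForm n) ∧
      PreservesVectors (u : CliffordAlgebra (stdForm n)) ∧
      u * ι (stdForm n) f = ι (stdForm n) (Pi.single k 1) * u ∧
      ∀ j < k, u * ι (stdForm n) (Pi.single j 1) = ι (stdForm n) (Pi.single j 1) * u by
    obtain ⟨u, hu, hue, hup, huk, huj⟩ := h
    refine ⟨u, hu, hue, hup, fun j hj => ?_⟩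
    rcases hj.eq_or_lt with rfl | hj
    · rw [mul_assoc, hf, ← mul_assoc, huk, mul_assoc]
    · rw [mul_assoc, hfix j hj, ← mul_assoc, huj j hj, mul_assoc]
  -- Each of the two vectors anticommutes with the basis vector, and the signs cancel.
  have comm : ∀ {a b : Fin n → ℂ} {j : Fin n}, a j = 0 → b j = 0 →
      ι (stdForm n) a * ι (stdForm n) b * ι (stdForm n) (Pi.single j 1) =
        ι (stdForm n) (Pi.single j 1) * (ι (stdForm n) a * ι (stdForm n) b) := by
    intro a b j ha hb
    rw [mul_assoc, ι_mul_single_comm hb, mul_neg, ← mul_assoc, ι_mul_single_comm ha, neg_mul,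
      neg_neg, mul_assoc]
  have hff : ι (stdForm n) f * ι (stdForm n) f = 1 := by rw [ι_sq_std, hQ, one_smul]
  have hkk := ι_single_mul_self k
  by_cases hA : stdForm n (f + Pi.single k 1) = 0
  -- The norms of `f + e_k` and `f - e_k` add up to `4`, so they cannot both vanish.
  · have hB : stdForm n (f - Pi.single k 1) ≠ 0 := by
      intro hB
      rw [stdForm_sub_single, hQ] at hB
      rw [stdForm_add_single, hQ] at hA
      have : (4 : ℂ) = 0 := by linear_combination hA + hB
      norm_num at this
    -- Conjugation by `f - e_k` sends `f` to `-e_k`; the spare vector `e_l` restores the sign and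
    -- makes the product even.
    obtain ⟨u, hu, huv, hue, hup⟩ :=
      exists_lipschitz_ι_mul_ι (a := Pi.single l 1) (by rw [stdForm_single]; exact one_ne_zero) hB
    refine ⟨u, hu, hue, hup, ?_, fun j hj => ?_⟩
    · have hlk : ι (stdForm n) (Pi.single k 1) * ι (stdForm n) (Pi.single l 1) =
          -(ι (stdForm n) (Pi.single l 1) * ι (stdForm n) (Pi.single k 1)) :=
        ι_mul_single_comm (Pi.single_eq_of_ne hkl.ne' 1)
      rw [huv, ← mul_assoc, hlk, neg_mul, mul_assoc, mul_assoc, ← mul_neg, map_sub, sub_mul, hff,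
        mul_sub (ι (stdForm n) (Pi.single k 1)), hkk, neg_sub]
    · rw [huv]
      apply comm
      · exact Pi.single_eq_of_ne (hj.trans hkl).ne 1
      · rw [Pi.sub_apply, hfj j hj, Pi.single_eq_of_ne hj.ne, sub_zero]
  -- Conjugation by `f + e_k` sends `f` to `e_k`; the further factor `e_k` keeps this image and
  -- makes the product even.
  · obtain ⟨u, hu, huv, hue, hup⟩ :=
      exists_lipschitz_ι_mul_ι (a := Pi.single k 1) (by rw [stdForm_single]; exact one_ne_zero) hA
    refine ⟨u, hu, hue, hup, ?_, fun j hj => ?_⟩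
    · rw [huv, ← mul_assoc, hkk, one_mul, mul_assoc, map_add, add_mul, hff, mul_add, mul_one,
        ← mul_assoc, hkk, one_mul, add_comm]
    · rw [huv]
      apply comm
      · exact Pi.single_eq_of_ne hj.ne 1
      · rw [Pi.add_apply, hfj j hj, Pi.single_eq_of_ne hj.ne, add_zero]

theorem commute_of_commute_basis {s : CliffordAlgebra (stdForm n)}
    (h : ∀ j, s * ι (stdForm n) (Pi.single j 1) = ι (stdForm n) (Pi.single j 1) * s)
    (t : CliffordAlgebra (stdForm n)) : Commute s t := by
  induction t using CliffordAlgebra.induction with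
  | algebraMap r => exact (Algebra.commutes r s).symm
  | ι v =>
    have hv : v = ∑ j, v j • (Pi.single j 1 : Fin n → ℂ) := by
      ext k
      simp [Pi.single_apply]
    rw [hv, map_sum]
    refine Commute.sum_right _ _ _ fun j _ => ?_
    rw [map_smul]
    exact Commute.smul_right (h j) _
  | mul a b ha hb => exact ha.mul_right hb
  | add a b ha hb => exact ha.add_right hb

/-- A nonzero scalar `c` is the product of the vectors `c e` and `e` for a unit vector `e`. -/
theorem algebraMap_mem_lipschitz {s : (CliffordAlgebra (stdForm 6))ˣ} {c : ℂ}
    (h : (s : CliffordAlgebra (stdForm 6)) = algebraMap ℂ _ c) :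
    s ∈ lipschitzGroup (stdForm 6) := by
  have hc : c ≠ 0 := by
    rintro rfl
    exact s.ne_zero (by rw [h, map_zero])
  obtain ⟨u, hu, hua, -, -⟩ := exists_lipschitz_ι_mul_ι (n := 6) (a := c • Pi.single 0 1)
    (b := Pi.single 0 1) (by simp [QuadraticMap.map_smul, stdForm_single, hc])
    (by simp [stdForm_single])
  convert hu
  rw [Units.ext_iff, hua, h, map_smul, smul_mul_assoc, ι_single_mul_self,
    Algebra.algebraMap_eq_smul_one]

/-- No invertible even element commutes with all basis vectors but the last and anticommutes with
the last. -/
theorem not_anticommute_last {s : (CliffordAlgebra (stdForm 6))ˣ}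
    (he : (s : CliffordAlgebra (stdForm 6)) ∈ even (stdForm 6))
    (hfix : ∀ j < 5, s * ι (stdForm 6) (Pi.single j 1) = ι (stdForm 6) (Pi.single j 1) * s)
    (h5 : s * ι (stdForm 6) (Pi.single 5 1) = -(ι (stdForm 6) (Pi.single 5 1) * s)) : False := by
  set v := ι (stdForm 6) (Pi.single 5 1) with hv
  have hvv : v * v = 1 := ι_single_mul_self _
  -- This product is odd and anticommutes with every basis vector.
  let t := (s : CliffordAlgebra (stdForm 6)) * v
  have htodd : involute t = -t := by
    simp only [t, map_mul, involute_eq_of_mem_even he, hv, involute_ι, mul_neg]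
  have htanti : ∀ j, t * ι (stdForm 6) (Pi.single j 1) = -(ι (stdForm 6) (Pi.single j 1) * t) := by
    intro j
    by_cases hj : j = 5
    · subst hj
      rw [← hv, ← mul_assoc, ← neg_mul, ← h5]
    · have hvj : v * ι (stdForm 6) (Pi.single j 1) = -(ι (stdForm 6) (Pi.single j 1) * v) :=
        ι_mul_single_comm (Pi.single_eq_of_ne hj 1)
      rw [mul_assoc, hvj, mul_neg, ← mul_assoc, hfix j (by omega), mul_assoc]
  -- A multiple of the volume element: it anticommutes with vectors, so `t * m` is central and hence
  -- scalar. But `m` anticommutes with the odd `t`, which forces `t = 0`.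
  let m := rhoEquiv.symm (L (e 1))
  have hmm : m * m = -1 := by
    apply rho_bijective.1
    ext1 y
    simp [m, e1_mul_e1_mul]
  have hmi : ∀ w, m * ι (stdForm 6) w = -(ι (stdForm 6) w * m) := by
    intro w
    apply rho_bijective.1
    ext1 y
    simp [m, rho_ι, e1_mul_inc_mul]
  have hinv : involute t * m = m * t := by
    apply rho_bijective.1
    rw [map_mul rho, map_mul rho, rho_rhoEquiv_symm, rho_involute_mul]
  obtain ⟨c, hc⟩ := exists_eq_algebraMap_of_commute (s := t * m)
    (commute_of_commute_basis fun j => by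
      rw [mul_assoc, hmi, mul_neg, ← mul_assoc, htanti, neg_mul, neg_neg, mul_assoc])
  have h1 : m * (t * m) = t * m * m := by rw [hc, Algebra.commutes]
  rw [← mul_assoc, ← hinv, htodd, mul_assoc, mul_assoc, hmm, mul_neg, mul_neg, mul_one,
    neg_neg] at h1
  have h2 : t = 0 := by
    have h2 : (2 : ℂ) • t = 0 := by
      rw [two_smul]
      nth_rw 1 [h1]
      rw [mul_one, neg_add_cancel]
    exact (smul_eq_zero.1 h2).resolve_left two_ne_zero
  have h3 : (s : CliffordAlgebra (stdForm 6)) = 0 := by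
    rw [← mul_one (s : CliffordAlgebra (stdForm 6)), ← hvv, ← mul_assoc]
    exact h2.symm ▸ zero_mul v
  exact s.ne_zero h3

/-- The image of the last basis vector has norm one and is orthogonal to the others, so it is plus
or minus that vector. The plus sign makes `s` scalar; the minus sign would be a reflection,
impossible for an even element. -/
theorem mem_lipschitz_of_fix {s : (CliffordAlgebra (stdForm 6))ˣ}
    (he : (s : CliffordAlgebra (stdForm 6)) ∈ even (stdForm 6))
    (hs : PreservesVectors (s : CliffordAlgebra (stdForm 6)))
    (hfix : ∀ j < 5, s * ι (stdForm 6) (Pi.single j 1) = ι (stdForm 6) (Pi.single j 1) * s) :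
    s ∈ lipschitzGroup (stdForm 6) := by
  obtain ⟨f, hf⟩ := hs (Pi.single 5 1)
  have hQ := stdForm_image hf
  have hfj : ∀ j < 5, f j = 0 := fun j hj => image_apply_eq_zero hf (hfix j hj) hj.ne
  have hf5 : f = f 5 • Pi.single 5 1 := by
    ext j
    by_cases hj : j = 5
    · simp [hj]
    · simp [hj, hfj j (by omega)]
  rw [hf5, QuadraticMap.map_smul, stdForm_single, smul_eq_mul, mul_one, mul_self_eq_one_iff] at hQ
  rcases hQ with h | h
  · rw [hf5, h, one_smul] at hf
    obtain ⟨c, hc⟩ := exists_eq_algebraMap_of_commute (s := s.1) (commute_of_commute_basis fun j => by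
      by_cases hj : j = 5
      · rw [hj]
        exact hf
      · exact hfix j (by omega))
    exact algebraMap_mem_lipschitz hc
  · rw [hf5, h, neg_one_smul, map_neg, neg_mul] at hf
    exact (not_anticommute_last he hfix hf).elim

/-- The even part of the Clifford group is contained in the Lipschitz group. -/
theorem mem_lipschitz {s : (CliffordAlgebra (stdForm 6))ˣ}
    (he : (s : CliffordAlgebra (stdForm 6)) ∈ even (stdForm 6))
    (hs : PreservesVectors (s : CliffordAlgebra (stdForm 6))) :
    s ∈ lipschitzGroup (stdForm 6) := by
  -- Induction on the number `m` of basis vectors among the first five not yet known to be fixed;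
  -- the sixth is never corrected.
  suffices h : ∀ m ≤ 5, ∀ s : (CliffordAlgebra (stdForm 6))ˣ,
      (s : CliffordAlgebra (stdForm 6)) ∈ even (stdForm 6) →
      PreservesVectors (s : CliffordAlgebra (stdForm 6)) →
      (∀ j : Fin 6, j.val + m < 5 →
        s * ι (stdForm 6) (Pi.single j 1) = ι (stdForm 6) (Pi.single j 1) * s) →
      s ∈ lipschitzGroup (stdForm 6) from
    h 5 le_rfl s he hs fun j hj => by omega
  intro m
  induction m with
  | zero =>
    intro _ s he hs hfix
    exact mem_lipschitz_of_fix he hs fun j hj => hfix j hj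
  | succ m ih =>
    intro hm s he hs hfix
    -- Index `4 - m` is the first one not known to be fixed, and `5` serves as the spare direction
    -- beyond it.
    obtain ⟨u, hu, hue, hup, huf⟩ := exists_lipschitz_fix (k := ⟨4 - m, by omega⟩) (l := 5)
      (by rw [Fin.lt_def]; change 4 - m < 5; omega) hs
      (fun j hj => hfix j (by rw [Fin.lt_def] at hj; change j.val < 4 - m at hj; omega))
    have h := ih (by omega) (u * s) (mul_mem hue he) (hup.mul hs)
      (fun j hj => huf j (by rw [Fin.le_def]; change j.val ≤ 4 - m; omega))
    exact (Subgroup.mul_mem_cancel_left _ hu).1 h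

theorem mem_spin {s : CliffordAlgebra (stdForm 6)} (he : s ∈ even (stdForm 6))
    (h1 : star s * s = 1) (h2 : s * star s = 1) (hs : PreservesVectors s) : s ∈ Spin 6 :=
  ⟨⟨⟨⟨s, star s, h2, h1⟩, mem_lipschitz he hs, rfl⟩, h1, h2⟩, he⟩

theorem Spin.preservesVectors {s : CliffordAlgebra (stdForm 6)} (hs : s ∈ Spin 6) :
    PreservesVectors s := by
  intro v
  let _ : Invertible (2 : ℂ) := invertibleOfNonzero two_ne_zero
  let u : (CliffordAlgebra (stdForm 6))ˣ := spinGroup.toUnits ⟨s, hs⟩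
  obtain ⟨w, hw⟩ := spinGroup.conjAct_smul_ι_mem_range_ι (x := u) hs v
  refine ⟨w, ?_⟩
  rw [hw, ConjAct.units_smul_def, ConjAct.ofConjAct_toConjAct]
  exact (Units.inv_mul_cancel_right (s * ι (stdForm 6) v) u).symm

/-! ### Coordinates on the exceptional Jordan algebra -/

/-- The element of `𝔍^C` with diagonal `ξ` and off-diagonal entries `x`, `y`, `z` in the positions
`(2,3)`, `(3,1)`, `(1,2)`. -/
noncomputable def mk (ξ : Fin 3 → ℂ) (x y z : CayleyC) : J :=
  ⟨!![ξ 0 • e 0, z, star y; star z, ξ 1 • e 0, x; y, star x, ξ 2 • e 0], by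
    rw [mem_J]
    ext i j : 1
    fin_cases i <;> fin_cases j <;> simp [Matrix.conjTranspose_apply, star_smul', star_e0]⟩

/-- The diagonal coordinates on `𝔍^C`. -/
noncomputable def diagL (i : Fin 3) : J →ₗ[ℂ] ℂ where
  toFun X := (X.1 i i).coord 0
  map_add' _ _ := rfl
  map_smul' _ _ := rfl

/-- The `(i, j)` entry of an element of `𝔍^C`. -/
noncomputable def entryL (i j : Fin 3) : J →ₗ[ℂ] CayleyC where
  toFun X := X.1 i j
  map_add' _ _ := rfl
  map_smul' _ _ := rfl

theorem diagL_apply (i : Fin 3) (X : J) : diagL i X = (X.1 i i).coord 0 := rfl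

theorem entryL_apply (i j : Fin 3) (X : J) : entryL i j X = X.1 i j := rfl

@[simp] theorem diagL_mk (ξ : Fin 3 → ℂ) (x y z : CayleyC) (i : Fin 3) :
    diagL i (mk ξ x y z) = ξ i := by
  fin_cases i <;> simp [diagL_apply, mk, e]

@[simp] theorem entryL_mk_1_2 (ξ : Fin 3 → ℂ) (x y z : CayleyC) :
    entryL 1 2 (mk ξ x y z) = x := rfl

@[simp] theorem entryL_mk_2_0 (ξ : Fin 3 → ℂ) (x y z : CayleyC) :
    entryL 2 0 (mk ξ x y z) = y := rfl

@[simp] theorem entryL_mk_0_1 (ξ : Fin 3 → ℂ) (x y z : CayleyC) :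
    entryL 0 1 (mk ξ x y z) = z := rfl

theorem star_entry (X : J) (i j : Fin 3) : star (X.1 i j) = X.1 j i := by
  have h := congr_fun (congr_fun (mem_J.1 X.2) j) i
  rwa [Matrix.conjTranspose_apply] at h

theorem coord_star_of_ne (x : CayleyC) {k : Fin 8} (hk : k ≠ 0) :
    (star x).coord k = -x.coord k := by
  fin_cases k <;> simp_all [coord_star]

/-- A diagonal entry of a Hermitian matrix is self-conjugate, so only its `e₀`-coordinate survives.
-/
theorem diag_entry (X : J) (i : Fin 3) : X.1 i i = diagL i X • e 0 := by
  ext k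
  by_cases h0 : k = 0
  · simp [h0, e, diagL_apply]
  · have hk := coord_star_of_ne (X.1 i i) h0
    rw [star_entry] at hk
    have hk0 : (X.1 i i).coord k = 0 := by linear_combination (1 / 2 : ℂ) * hk
    simp [h0, e, hk0]

theorem entry_1_0 (X : J) : X.1 1 0 = star (X.1 0 1) := (star_entry X 0 1).symm

theorem entry_2_1 (X : J) : X.1 2 1 = star (X.1 1 2) := (star_entry X 1 2).symm

theorem entry_0_2 (X : J) : X.1 0 2 = star (X.1 2 0) := (star_entry X 2 0).symm

theorem eq_mk (X : J) :
    X = mk (fun i => diagL i X) (entryL 1 2 X) (entryL 2 0 X) (entryL 0 1 X) := by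
  apply Subtype.ext
  ext i j : 1
  fin_cases i <;> fin_cases j
  exacts [diag_entry X 0, rfl, entry_0_2 X, entry_1_0 X, diag_entry X 1, rfl, rfl, entry_2_1 X,
    diag_entry X 2]

theorem J_ext {X Y : J} (hd : ∀ i, diagL i X = diagL i Y) (h1 : entryL 1 2 X = entryL 1 2 Y)
    (h2 : entryL 2 0 X = entryL 2 0 Y) (h3 : entryL 0 1 X = entryL 0 1 Y) : X = Y := by
  rw [eq_mk X, eq_mk Y, h1, h2, h3, funext hd]

theorem E_eq_mk (i : Fin 3) : E i = mk (Pi.single i 1) 0 0 0 := by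
  apply Subtype.ext
  ext a b : 1
  fin_cases i <;> fin_cases a <;> fin_cases b <;> simp [E, mk]

theorem F1_eq_mk (x : CayleyC) : F1 x = mk 0 x 0 0 := by
  apply Subtype.ext
  ext a b : 1
  fin_cases a <;> fin_cases b <;> simp [F1, mk]

theorem entry_jordan (X Y : J) (i j : Fin 3) :
    (jordan X Y).1 i j = (1 / 2 : ℂ) • (∑ k, X.1 i k * Y.1 k j + ∑ k, Y.1 i k * X.1 k j) := rfl

theorem coord_zero_mul_star (x y : CayleyC) : (x * star y).coord 0 = ip x y := by
  simp [coord_mul, coord_star, ip, Fin.sum_univ_eight]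

theorem coord_zero_star_mul (x y : CayleyC) : (star x * y).coord 0 = ip x y := by
  simp [coord_mul, coord_star, ip, Fin.sum_univ_eight]

theorem coord_zero_e : (e 0).coord 0 = 1 := by simp [e]

theorem diagL_jordan_0 (X Y : J) : diagL 0 (jordan X Y) = diagL 0 X * diagL 0 Y +
    ip (entryL 2 0 X) (entryL 2 0 Y) + ip (entryL 0 1 X) (entryL 0 1 Y) := by
  change ((jordan X Y).1 0 0).coord 0 = _
  rw [entry_jordan]
  simp only [Fin.sum_univ_three, diag_entry, entry_1_0, entry_0_2, coord_add, coord_smul,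
    Pi.add_apply, Pi.smul_apply, coord_zero_mul_star, coord_zero_star_mul, smul_mul_assoc,
    mul_smul_comm, e0_mul, coord_zero_e, smul_eq_mul]
  rw [ip_comm (Y.1 0 1), ip_comm (Y.1 2 0)]
  simp only [entryL_apply]
  ring

theorem diagL_jordan_1 (X Y : J) : diagL 1 (jordan X Y) = diagL 1 X * diagL 1 Y +
    ip (entryL 1 2 X) (entryL 1 2 Y) + ip (entryL 0 1 X) (entryL 0 1 Y) := by
  change ((jordan X Y).1 1 1).coord 0 = _
  rw [entry_jordan]
  simp only [Fin.sum_univ_three, diag_entry, entry_1_0, entry_2_1, coord_add, coord_smul,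
    Pi.add_apply, Pi.smul_apply, coord_zero_mul_star, coord_zero_star_mul, smul_mul_assoc,
    mul_smul_comm, e0_mul, coord_zero_e, smul_eq_mul]
  rw [ip_comm (Y.1 0 1), ip_comm (Y.1 1 2)]
  simp only [entryL_apply]
  ring

theorem diagL_jordan_2 (X Y : J) : diagL 2 (jordan X Y) = diagL 2 X * diagL 2 Y +
    ip (entryL 1 2 X) (entryL 1 2 Y) + ip (entryL 2 0 X) (entryL 2 0 Y) := by
  change ((jordan X Y).1 2 2).coord 0 = _
  rw [entry_jordan]
  simp only [Fin.sum_univ_three, diag_entry, entry_0_2, entry_2_1, coord_add, coord_smul,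
    Pi.add_apply, Pi.smul_apply, coord_zero_mul_star, coord_zero_star_mul, smul_mul_assoc,
    mul_smul_comm, e0_mul, coord_zero_e, smul_eq_mul]
  rw [ip_comm (Y.1 2 0), ip_comm (Y.1 1 2)]
  simp only [entryL_apply]
  ring

theorem entryL_jordan_1_2 (X Y : J) : entryL 1 2 (jordan X Y) = (1 / 2 : ℂ) •
    ((diagL 1 X + diagL 2 X) • entryL 1 2 Y + (diagL 1 Y + diagL 2 Y) • entryL 1 2 X +
      star (entryL 2 0 X * entryL 0 1 Y) + star (entryL 2 0 Y * entryL 0 1 X)) := by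
  change (jordan X Y).1 1 2 = _
  rw [entry_jordan]
  simp only [Fin.sum_univ_three, diag_entry, entry_1_0, entry_0_2, smul_mul_assoc,
    mul_smul_comm, e0_mul, mul_e0, star_mul, entryL_apply]
  module

theorem entryL_jordan_2_0 (X Y : J) : entryL 2 0 (jordan X Y) = (1 / 2 : ℂ) •
    ((diagL 2 X + diagL 0 X) • entryL 2 0 Y + (diagL 2 Y + diagL 0 Y) • entryL 2 0 X +
      star (entryL 0 1 X * entryL 1 2 Y) + star (entryL 0 1 Y * entryL 1 2 X)) := by
  change (jordan X Y).1 2 0 = _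
  rw [entry_jordan]
  simp only [Fin.sum_univ_three, diag_entry, entry_1_0, entry_2_1, smul_mul_assoc,
    mul_smul_comm, e0_mul, mul_e0, star_mul, entryL_apply]
  module

theorem entryL_jordan_0_1 (X Y : J) : entryL 0 1 (jordan X Y) = (1 / 2 : ℂ) •
    ((diagL 0 X + diagL 1 X) • entryL 0 1 Y + (diagL 0 Y + diagL 1 Y) • entryL 0 1 X +
      star (entryL 1 2 X * entryL 2 0 Y) + star (entryL 1 2 Y * entryL 2 0 X)) := by
  change (jordan X Y).1 0 1 = _
  rw [entry_jordan]
  simp only [Fin.sum_univ_three, diag_entry, entry_0_2, entry_2_1, smul_mul_assoc,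
    mul_smul_comm, e0_mul, mul_e0, star_mul, entryL_apply]
  module

instance : Module.Finite ℂ J := by
  have h : Function.Injective (LinearMap.pi fun p : Fin 3 × Fin 3 => entryL p.1 p.2) := by
    intro X Y h
    apply Subtype.ext
    ext i j : 1
    exact congr_fun h (i, j)
  exact Module.Finite.of_injective _ h

/-! ### Triality triples -/

/-- The endomorphism of `𝔍^C` acting by `a`, `b`, `c` on the off-diagonal entries and fixing the
diagonal. -/
noncomputable def assemble (a b c : Module.End ℂ CayleyC) : Module.End ℂ J where
  toFun X := mk (fun i => diagL i X) (a (entryL 1 2 X)) (b (entryL 2 0 X)) (c (entryL 0 1 X))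
  map_add' X Y := by apply J_ext <;> simp
  map_smul' r X := by apply J_ext <;> simp

theorem assemble_apply (a b c : Module.End ℂ CayleyC) (X : J) : assemble a b c X =
    mk (fun i => diagL i X) (a (entryL 1 2 X)) (b (entryL 2 0 X)) (c (entryL 0 1 X)) := rfl

theorem assemble_mk (a b c : Module.End ℂ CayleyC) (ξ : Fin 3 → ℂ) (x y z : CayleyC) :
    assemble a b c (mk ξ x y z) = mk ξ (a x) (b y) (c z) := by
  apply J_ext <;> simp [assemble_apply]

theorem assemble_mul (a b c a' b' c' : Module.End ℂ CayleyC) :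
    assemble a b c * assemble a' b' c' = assemble (a * a') (b * b') (c * c') := by
  ext1 X
  apply J_ext <;> simp [assemble_apply]

theorem assemble_one : assemble 1 1 1 = 1 := by
  ext1 X
  exact (eq_mk X).symm

/-- A triple of orthogonal maps of `ℭ^C` related by triality. -/
structure IsTriality (a b c : Module.End ℂ CayleyC) : Prop where
  ip_fst : ∀ x y, ip (a x) (a y) = ip x y
  ip_snd : ∀ x y, ip (b x) (b y) = ip x y
  ip_trd : ∀ x y, ip (c x) (c y) = ip x y
  fst_mul_snd : ∀ x y, star (a x * b y) = c (star (x * y))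
  snd_mul_trd : ∀ x y, star (b x * c y) = a (star (x * y))
  trd_mul_fst : ∀ x y, star (c x * a y) = b (star (x * y))

theorem IsTriality.assemble_jordan {a b c : Module.End ℂ CayleyC} (h : IsTriality a b c)
    (X Y : J) : assemble a b c (jordan X Y) = jordan (assemble a b c X) (assemble a b c Y) := by
  have hd : ∀ X i, diagL i (assemble a b c X) = diagL i X := fun X i => by simp [assemble_apply]
  have h1 : ∀ X, entryL 1 2 (assemble a b c X) = a (entryL 1 2 X) := fun X => rfl
  have h2 : ∀ X, entryL 2 0 (assemble a b c X) = b (entryL 2 0 X) := fun X => rfl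
  have h3 : ∀ X, entryL 0 1 (assemble a b c X) = c (entryL 0 1 X) := fun X => rfl
  apply J_ext
  · intro i
    rw [hd]
    fin_cases i
    · simp [diagL_jordan_0, hd, h2, h3, h.ip_snd, h.ip_trd]
    · simp [diagL_jordan_1, hd, h1, h3, h.ip_fst, h.ip_trd]
    · simp [diagL_jordan_2, hd, h1, h2, h.ip_fst, h.ip_snd]
  · simp only [entryL_jordan_1_2, hd, h1, h2, h3, h.snd_mul_trd, map_smul, map_add]
  · simp only [entryL_jordan_2_0, hd, h1, h2, h3, h.trd_mul_fst, map_smul, map_add]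
  · simp only [entryL_jordan_0_1, hd, h1, h2, h3, h.fst_mul_snd, map_smul, map_add]

theorem surjective_of_ip {a : Module.End ℂ CayleyC} (h : ∀ x y, ip (a x) (a y) = ip x y) :
    Function.Surjective a := by
  rw [← LinearMap.injective_iff_surjective]
  intro x y hxy
  apply ext_ip
  intro z
  rw [← h, hxy, h]

/-- The principle of triality: one of the three relations implies the other two. -/
theorem isTriality_of_mul {a b : Module.End ℂ CayleyC} (ha : ∀ x y, ip (a x) (a y) = ip x y)
    (hb : ∀ x y, ip (b x) (b y) = ip x y) (h : ∀ x y, a x * b y = b (x * y)) :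
    IsTriality a b (conjL ∘ₗ b ∘ₗ conjL) where
  ip_fst := ha
  ip_snd := hb
  ip_trd x y := by simp [ip_star_star, hb]
  fst_mul_snd x y := by simp only [LinearMap.comp_apply, conjL_apply, star_star, h]
  snd_mul_trd x y := by
    apply ext_ip
    intro w
    -- The form is nondegenerate and `a` is surjective, so testing against `a z` suffices; cyclicity
    -- of the trilinear form then carries the hypothesis over.
    obtain ⟨z, rfl⟩ := surjective_of_ip ha w
    rw [ha, ← ip_star_star, star_star, ← ip_mul_star_cyclic, h]
    simp only [LinearMap.comp_apply, conjL_apply, star_star]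
    rw [hb, ip_mul_star_cyclic, ← ip_star_star, star_star]
  trd_mul_fst x y := by
    apply ext_ip
    intro w
    obtain ⟨z, rfl⟩ := surjective_of_ip hb w
    rw [hb, ← ip_star_star, star_star, ip_mul_star_cyclic, h]
    simp only [LinearMap.comp_apply, conjL_apply, star_star]
    rw [hb, ← ip_mul_star_cyclic, ← ip_star_star, star_star]

/-! ### The structure of the stabilizer -/

/-- The simultaneous `1/2`-eigenspace of two diagonal idempotents is an off-diagonal Peirce space.
Being described by the Jordan product and the `E i`, it is preserved by the stabilizer. -/
theorem eq_mk_fst {X : J} (h1 : jordan (E 1) X = (1 / 2 : ℂ) • X)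
    (h2 : jordan (E 2) X = (1 / 2 : ℂ) • X) : X = mk 0 (entryL 1 2 X) 0 0 := by
  have d0 := congrArg (diagL 0) h1
  have d1 := congrArg (diagL 1) h1
  have d2 := congrArg (diagL 2) h2
  have e2 := (congrArg (entryL 2 0) h1).symm
  have e3 := (congrArg (entryL 0 1) h2).symm
  simp [E_eq_mk, diagL_jordan_0, ip] at d0
  simp [E_eq_mk, diagL_jordan_1, ip] at d1
  simp [E_eq_mk, diagL_jordan_2, ip] at d2
  simp [E_eq_mk, entryL_jordan_2_0] at e2
  simp [E_eq_mk, entryL_jordan_0_1] at e3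
  apply J_ext
  · intro i
    fin_cases i <;> simp <;> grind
  all_goals simp [e2, e3]

theorem eq_mk_snd {X : J} (h1 : jordan (E 2) X = (1 / 2 : ℂ) • X)
    (h2 : jordan (E 0) X = (1 / 2 : ℂ) • X) : X = mk 0 0 (entryL 2 0 X) 0 := by
  have d0 := congrArg (diagL 0) h2
  have d1 := congrArg (diagL 1) h1
  have d2 := congrArg (diagL 2) h1
  have e1 := (congrArg (entryL 1 2) h2).symm
  have e3 := (congrArg (entryL 0 1) h1).symm
  simp [E_eq_mk, diagL_jordan_0, ip] at d0
  simp [E_eq_mk, diagL_jordan_1, ip] at d1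
  simp [E_eq_mk, diagL_jordan_2, ip] at d2
  simp [E_eq_mk, entryL_jordan_1_2] at e1
  simp [E_eq_mk, entryL_jordan_0_1] at e3
  apply J_ext
  · intro i
    fin_cases i <;> simp <;> grind
  all_goals simp [e1, e3]

theorem eq_mk_trd {X : J} (h1 : jordan (E 0) X = (1 / 2 : ℂ) • X)
    (h2 : jordan (E 1) X = (1 / 2 : ℂ) • X) : X = mk 0 0 0 (entryL 0 1 X) := by
  have d0 := congrArg (diagL 0) h1
  have d1 := congrArg (diagL 1) h2
  have d2 := congrArg (diagL 2) h1
  have e1 := (congrArg (entryL 1 2) h1).symm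
  have e2 := (congrArg (entryL 2 0) h2).symm
  simp [E_eq_mk, diagL_jordan_0, ip] at d0
  simp [E_eq_mk, diagL_jordan_1, ip] at d1
  simp [E_eq_mk, diagL_jordan_2, ip] at d2
  simp [E_eq_mk, entryL_jordan_1_2] at e1
  simp [E_eq_mk, entryL_jordan_2_0] at e2
  apply J_ext
  · intro i
    fin_cases i <;> simp <;> grind
  all_goals simp [e1, e2]

/-- The elements of `𝔍^C` supported on the positions `(2,3)` and `(3,2)`. -/
noncomputable def emb1 : CayleyC →ₗ[ℂ] J where
  toFun x := mk 0 x 0 0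
  map_add' x y := by apply J_ext <;> simp
  map_smul' c x := by apply J_ext <;> simp

/-- The elements of `𝔍^C` supported on the positions `(3,1)` and `(1,3)`. -/
noncomputable def emb2 : CayleyC →ₗ[ℂ] J where
  toFun x := mk 0 0 x 0
  map_add' x y := by apply J_ext <;> simp
  map_smul' c x := by apply J_ext <;> simp

/-- The elements of `𝔍^C` supported on the positions `(1,2)` and `(2,1)`. -/
noncomputable def emb3 : CayleyC →ₗ[ℂ] J where
  toFun x := mk 0 0 0 x
  map_add' x y := by apply J_ext <;> simp
  map_smul' c x := by apply J_ext <;> simp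

theorem emb1_apply (x : CayleyC) : emb1 x = mk 0 x 0 0 := rfl

theorem emb2_apply (x : CayleyC) : emb2 x = mk 0 0 x 0 := rfl

theorem emb3_apply (x : CayleyC) : emb3 x = mk 0 0 0 x := rfl

theorem eq_sum (X : J) : X = diagL 0 X • E 0 + diagL 1 X • E 1 + diagL 2 X • E 2 +
    emb1 (entryL 1 2 X) + emb2 (entryL 2 0 X) + emb3 (entryL 0 1 X) := by
  apply J_ext
  · intro i
    fin_cases i <;> simp [E_eq_mk, emb1_apply, emb2_apply, emb3_apply]
  all_goals simp [E_eq_mk, emb1_apply, emb2_apply, emb3_apply]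

theorem jordan_E_emb1 {i : Fin 3} (hi : i ≠ 0) (x : CayleyC) :
    jordan (E i) (emb1 x) = (1 / 2 : ℂ) • emb1 x := by
  apply J_ext
  · intro j
    fin_cases j <;>
      simp [E_eq_mk, emb1_apply, diagL_jordan_0, diagL_jordan_1, diagL_jordan_2, ip]
  · fin_cases i <;> simp_all [E_eq_mk, emb1_apply, entryL_jordan_1_2]
  · simp [E_eq_mk, emb1_apply, entryL_jordan_2_0]
  · simp [E_eq_mk, emb1_apply, entryL_jordan_0_1]

theorem jordan_E_emb2 {i : Fin 3} (hi : i ≠ 1) (x : CayleyC) :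
    jordan (E i) (emb2 x) = (1 / 2 : ℂ) • emb2 x := by
  apply J_ext
  · intro j
    fin_cases j <;>
      simp [E_eq_mk, emb2_apply, diagL_jordan_0, diagL_jordan_1, diagL_jordan_2, ip]
  · simp [E_eq_mk, emb2_apply, entryL_jordan_1_2]
  · fin_cases i <;> simp_all [E_eq_mk, emb2_apply, entryL_jordan_2_0]
  · simp [E_eq_mk, emb2_apply, entryL_jordan_0_1]

theorem jordan_E_emb3 {i : Fin 3} (hi : i ≠ 2) (x : CayleyC) :
    jordan (E i) (emb3 x) = (1 / 2 : ℂ) • emb3 x := by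
  apply J_ext
  · intro j
    fin_cases j <;>
      simp [E_eq_mk, emb3_apply, diagL_jordan_0, diagL_jordan_1, diagL_jordan_2, ip]
  · simp [E_eq_mk, emb3_apply, entryL_jordan_1_2]
  · simp [E_eq_mk, emb3_apply, entryL_jordan_2_0]
  · fin_cases i <;> simp_all [E_eq_mk, emb3_apply, entryL_jordan_0_1]

theorem jordan_emb1_emb2 (x y : CayleyC) :
    jordan (emb1 x) (emb2 y) = (1 / 2 : ℂ) • emb3 (star (x * y)) := by
  apply J_ext
  · intro j
    fin_cases j <;>
      simp [emb1_apply, emb2_apply, emb3_apply, diagL_jordan_0, diagL_jordan_1, diagL_jordan_2, ip]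
  · simp [emb1_apply, emb2_apply, emb3_apply, entryL_jordan_1_2]
  · simp [emb1_apply, emb2_apply, emb3_apply, entryL_jordan_2_0]
  · simp [emb1_apply, emb2_apply, emb3_apply, entryL_jordan_0_1]

/-- The Jordan product on a Peirce space encodes the bilinear form, so automorphisms in the
stabilizer act on it orthogonally. -/
theorem jordan_self_emb1 (x y : CayleyC) :
    jordan (emb1 x) (emb1 y) = ip x y • (E 1 + E 2) := by
  apply J_ext
  · intro j
    fin_cases j <;>
      simp [emb1_apply, E_eq_mk, diagL_jordan_0, diagL_jordan_1, diagL_jordan_2] <;> simp [ip]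
  · simp [emb1_apply, E_eq_mk, entryL_jordan_1_2]
  · simp [emb1_apply, E_eq_mk, entryL_jordan_2_0]
  · simp [emb1_apply, E_eq_mk, entryL_jordan_0_1]

theorem jordan_self_emb2 (x y : CayleyC) :
    jordan (emb2 x) (emb2 y) = ip x y • (E 2 + E 0) := by
  apply J_ext
  · intro j
    fin_cases j <;>
      simp [emb2_apply, E_eq_mk, diagL_jordan_0, diagL_jordan_1, diagL_jordan_2] <;> simp [ip]
  · simp [emb2_apply, E_eq_mk, entryL_jordan_1_2]
  · simp [emb2_apply, E_eq_mk, entryL_jordan_2_0]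
  · simp [emb2_apply, E_eq_mk, entryL_jordan_0_1]

section Stabilizer

variable (α : stab)

theorem stab_E (i : Fin 3) : stabToEnd α (E i) = E i := α.2.1 i

theorem stab_jordan (X Y : J) :
    stabToEnd α (jordan X Y) = jordan (stabToEnd α X) (stabToEnd α Y) := α.1.2 X Y

/-- The component of an endomorphism of `𝔍^C` on the entries at `(2,3)`. -/
noncomputable def comp1 : Module.End ℂ J →ₗ[ℂ] Module.End ℂ CayleyC where
  toFun A := entryL 1 2 ∘ₗ A ∘ₗ emb1
  map_add' A B := by ext1 x; simp
  map_smul' c A := by ext1 x; simp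

/-- The component of an endomorphism of `𝔍^C` on the entries at `(3,1)`. -/
noncomputable def comp2 : Module.End ℂ J →ₗ[ℂ] Module.End ℂ CayleyC where
  toFun A := entryL 2 0 ∘ₗ A ∘ₗ emb2
  map_add' A B := by ext1 x; simp
  map_smul' c A := by ext1 x; simp

/-- The component of an endomorphism of `𝔍^C` on the entries at `(1,2)`. -/
noncomputable def comp3 : Module.End ℂ J →ₗ[ℂ] Module.End ℂ CayleyC where
  toFun A := entryL 0 1 ∘ₗ A ∘ₗ emb3
  map_add' A B := by ext1 x; simp
  map_smul' c A := by ext1 x; simp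

theorem stab_jordan_E (i : Fin 3) {X : J} (h : jordan (E i) X = (1 / 2 : ℂ) • X) :
    jordan (E i) (stabToEnd α X) = (1 / 2 : ℂ) • stabToEnd α X := by
  rw [← map_smul, ← h, stab_jordan, stab_E]

theorem stab_emb1 (x : CayleyC) : stabToEnd α (emb1 x) = emb1 (comp1 (stabToEnd α) x) :=
  eq_mk_fst (stab_jordan_E α 1 (jordan_E_emb1 (by decide) x))
    (stab_jordan_E α 2 (jordan_E_emb1 (by decide) x))

theorem stab_emb2 (x : CayleyC) : stabToEnd α (emb2 x) = emb2 (comp2 (stabToEnd α) x) :=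
  eq_mk_snd (stab_jordan_E α 2 (jordan_E_emb2 (by decide) x))
    (stab_jordan_E α 0 (jordan_E_emb2 (by decide) x))

theorem stab_emb3 (x : CayleyC) : stabToEnd α (emb3 x) = emb3 (comp3 (stabToEnd α) x) :=
  eq_mk_trd (stab_jordan_E α 0 (jordan_E_emb3 (by decide) x))
    (stab_jordan_E α 1 (jordan_E_emb3 (by decide) x))

theorem stabToEnd_eq_assemble : stabToEnd α =
    assemble (comp1 (stabToEnd α)) (comp2 (stabToEnd α)) (comp3 (stabToEnd α)) := by
  ext1 X
  conv_lhs => rw [eq_sum X]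
  rw [eq_sum (assemble _ _ _ X)]
  simp only [map_add, map_smul, stab_E, stab_emb1, stab_emb2, stab_emb3]
  simp [assemble_apply]

theorem star_comp1_mul_comp2 (x y : CayleyC) :
    star (comp1 (stabToEnd α) x * comp2 (stabToEnd α) y) =
      comp3 (stabToEnd α) (star (x * y)) := by
  have h := stab_jordan α (emb1 x) (emb2 y)
  rw [jordan_emb1_emb2, map_smul, stab_emb1, stab_emb2, stab_emb3, jordan_emb1_emb2] at h
  have h' := congrArg (entryL 0 1) (smul_right_injective J (by norm_num : (1 / 2 : ℂ) ≠ 0) h)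
  exact h'.symm

theorem comp1_e0 : comp1 (stabToEnd α) (e 0) = e 0 := by
  have h : stabToEnd α (F1 (e 0)) = F1 (e 0) := α.2.2.1
  rw [F1_eq_mk] at h
  exact congrArg (entryL 1 2) h

theorem comp1_e1 : comp1 (stabToEnd α) (e 1) = e 1 := by
  have h : stabToEnd α (F1 (e 1)) = F1 (e 1) := α.2.2.2
  rw [F1_eq_mk] at h
  exact congrArg (entryL 1 2) h

/-- Put `e₀`, which the first component fixes, into the triality relation. -/
theorem comp3_eq : comp3 (stabToEnd α) = conjL ∘ₗ comp2 (stabToEnd α) ∘ₗ conjL := by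
  ext1 x
  have h := star_comp1_mul_comp2 α (e 0) (star x)
  rw [comp1_e0, e0_mul, e0_mul, star_star] at h
  exact h.symm

theorem comp1_mul_comp2 (x y : CayleyC) :
    comp1 (stabToEnd α) x * comp2 (stabToEnd α) y = comp2 (stabToEnd α) (x * y) := by
  have h := congrArg star (star_comp1_mul_comp2 α x y)
  rw [comp3_eq] at h
  simpa using h

theorem ip_comp1 (x y : CayleyC) :
    ip (comp1 (stabToEnd α) x) (comp1 (stabToEnd α) y) = ip x y := by
  have h := stab_jordan α (emb1 x) (emb1 y)
  rw [jordan_self_emb1, map_smul, map_add, stab_E, stab_E, stab_emb1, stab_emb1,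
    jordan_self_emb1] at h
  simpa [E_eq_mk] using (congrArg (diagL 1) h).symm

theorem ip_comp2 (x y : CayleyC) :
    ip (comp2 (stabToEnd α) x) (comp2 (stabToEnd α) y) = ip x y := by
  have h := stab_jordan α (emb2 x) (emb2 y)
  rw [jordan_self_emb2, map_smul, map_add, stab_E, stab_E, stab_emb2, stab_emb2,
    jordan_self_emb2] at h
  simpa [E_eq_mk] using (congrArg (diagL 2) h).symm

/-- An orthogonal map fixing `e₀` and `e₁` preserves their orthogonal complement. -/
theorem exists_comp1_inc (v : Fin 6 → ℂ) : ∃ w, comp1 (stabToEnd α) (inc v) = inc w := by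
  have h0 : (comp1 (stabToEnd α) (inc v)).coord 0 = 0 := by
    rw [← ip_e]
    nth_rw 1 [← comp1_e0 α]
    rw [ip_comp1, ip_e, coord_inc]
    rfl
  have h1 : (comp1 (stabToEnd α) (inc v)).coord 1 = 0 := by
    rw [← ip_e]
    nth_rw 1 [← comp1_e1 α]
    rw [ip_comp1, ip_e, coord_inc]
    rfl
  have h := eq_add_inc (comp1 (stabToEnd α) (inc v))
  rw [h0, h1, zero_smul, zero_smul, zero_add, zero_add] at h
  exact ⟨_, h⟩

theorem mul_star_of_star_mul {s : CliffordAlgebra (stdForm 6)} (h : star s * s = 1) :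
    s * star s = 1 := by
  apply rho_bijective.1
  rw [map_mul, map_one, mul_eq_one_comm, ← map_mul, h, map_one]

/-- Orthogonality of the second component gives unitarity, fixing `e₁` gives evenness, and `a x * b
y = b (x * y)` says that conjugation sends the vector `v` to the one given by `a`. -/
theorem rhoEquiv_symm_comp2_mem : rhoEquiv.symm (comp2 (stabToEnd α)) ∈ Spin 6 := by
  have hstar : star (rhoEquiv.symm (comp2 (stabToEnd α))) *
      rhoEquiv.symm (comp2 (stabToEnd α)) = 1 := by
    apply rho_bijective.1
    ext1 x
    apply ext_ip
    intro z
    rw [map_mul, Module.End.mul_apply, ip_comm, ← ip_rho, rho_rhoEquiv_symm, ip_comp2, map_one,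
      Module.End.one_apply, ip_comm]
  refine mem_spin ?_ hstar (mul_star_of_star_mul hstar) fun v => ?_
  · rw [mem_even_iff]
    intro y
    rw [rho_rhoEquiv_symm, ← comp1_mul_comp2, comp1_e1]
  · obtain ⟨w, hw⟩ := exists_comp1_inc α v
    refine ⟨w, rho_bijective.1 ?_⟩
    ext1 y
    rw [map_mul, map_mul, Module.End.mul_apply, Module.End.mul_apply, rho_ι_apply, rho_ι_apply,
      rho_rhoEquiv_symm, map_smul, ← comp1_mul_comp2, hw]

end Stabilizer

/-! ### The action of the spin group -/

/-- The vector representation of the spin group on `ℭ^C`, polarized. -/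
noncomputable def vecRep : CliffordAlgebra (stdForm 6) →ₗ[ℂ]
    CliffordAlgebra (stdForm 6) →ₗ[ℂ] Module.End ℂ CayleyC :=
  LinearMap.mk₂ ℂ (fun s t => rho s ∘ₗ (LinearMap.mul ℂ CayleyC).flip (rho (star t) (e 0)))
    (fun s s' t => by ext1 x; simp) (fun c s t => by ext1 x; simp)
    (fun s t t' => by ext1 x; simp) (fun c s t => by ext1 x; simp)

theorem vecRep_apply (s t : CliffordAlgebra (stdForm 6)) (x : CayleyC) :
    vecRep s t x = rho s (x * rho (star t) (e 0)) := rfl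

theorem rho_rho_star {s : CliffordAlgebra (stdForm 6)} (hs : s ∈ Spin 6)
    (x : CayleyC) : rho s (rho (star s) x) = x := by
  rw [← Module.End.mul_apply, ← map_mul, spinGroup.mul_star_self_of_mem hs, map_one,
    Module.End.one_apply]

theorem rho_star_rho {s : CliffordAlgebra (stdForm 6)} (hs : s ∈ Spin 6)
    (x : CayleyC) : rho (star s) (rho s x) = x := by
  rw [← Module.End.mul_apply, ← map_mul, spinGroup.star_mul_self_of_mem hs, map_one,
    Module.End.one_apply]

theorem ip_rho_rho {s : CliffordAlgebra (stdForm 6)} (hs : s ∈ Spin 6)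
    (x y : CayleyC) : ip (rho s x) (rho s y) = ip x y := by
  rw [ip_rho, rho_star_rho hs]

theorem rho_e1_mul {s : CliffordAlgebra (stdForm 6)} (hs : s ∈ Spin 6)
    (y : CayleyC) : rho s (e 1 * y) = e 1 * rho s y :=
  (mem_even_iff s).1 (spinGroup.mem_even hs) y

/-- On the span of `e₂, …, e₇` this is preservation of vectors; `e₀` acts as the identity and `e₁`
commutes with `rho s` by evenness. -/
theorem exists_rho_mul {s : CliffordAlgebra (stdForm 6)} (hs : s ∈ Spin 6)
    (x : CayleyC) : ∃ x', ∀ y, rho s (x * y) = x' * rho s y := by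
  obtain ⟨w, hw⟩ := Spin.preservesVectors hs
    ![x.coord 2, x.coord 3, x.coord 4, x.coord 5, x.coord 6, x.coord 7]
  have hw' : ∀ y, rho s (inc ![x.coord 2, x.coord 3, x.coord 4, x.coord 5, x.coord 6, x.coord 7] *
      y) = inc w * rho s y := by
    intro y
    have h := LinearMap.congr_fun (congrArg rho hw) y
    simp only [map_mul, Module.End.mul_apply, rho_ι_apply, map_smul] at h
    exact smul_right_injective _ Complex.I_ne_zero h
  refine ⟨x.coord 0 • e 0 + x.coord 1 • e 1 + inc w, fun y => ?_⟩
  conv_lhs => rw [eq_add_inc x]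
  simp only [add_mul, smul_mul_assoc, map_add, map_smul, e0_mul, rho_e1_mul hs, hw']

/-- Evaluating `rho s (x * y) = x' * rho s y` at `y = rho (star s) e₀` identifies `x'` with `vecRep
s s x`. -/
theorem vecRep_mul_rho {s : CliffordAlgebra (stdForm 6)} (hs : s ∈ Spin 6)
    (x y : CayleyC) : vecRep s s x * rho s y = rho s (x * y) := by
  obtain ⟨x', hx'⟩ := exists_rho_mul hs x
  rw [vecRep_apply, hx', rho_rho_star hs, mul_e0, hx']

theorem ip_vecRep {s : CliffordAlgebra (stdForm 6)} (hs : s ∈ Spin 6)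
    (x y : CayleyC) : ip (vecRep s s x) (vecRep s s y) = ip x y := by
  have h : ip (e 0) (e 0) = 1 := by rw [ip_e, coord_zero_e]
  rw [vecRep_apply, vecRep_apply, ip_rho_rho hs, ip_mul_mul_right,
    ip_rho_rho (spinGroup.star_mem hs), h, mul_one]

theorem isTriality_spin {s : CliffordAlgebra (stdForm 6)} (hs : s ∈ Spin 6) :
    IsTriality (vecRep s s) (rho s) (conjL ∘ₗ rho s ∘ₗ conjL) :=
  isTriality_of_mul (ip_vecRep hs) (ip_rho_rho hs) (vecRep_mul_rho hs)

/-- The action of the Clifford algebra on `𝔍^C`, which is multiplicative on the spin group. -/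
noncomputable def action (s : CliffordAlgebra (stdForm 6)) : Module.End ℂ J :=
  assemble (vecRep s s) (rho s) (conjL ∘ₗ rho s ∘ₗ conjL)

theorem action_mul_action_star {s : CliffordAlgebra (stdForm 6)} (hs : s ∈ Spin 6) :
    action s * action (star s) = 1 := by
  rw [action, action, assemble_mul, ← assemble_one]
  congr 1
  · ext1 x
    rw [Module.End.mul_apply, vecRep_apply s, vecRep_mul_rho (spinGroup.star_mem hs), mul_e0,
      rho_rho_star hs, Module.End.one_apply]
  · rw [← map_mul, spinGroup.mul_star_self_of_mem hs, map_one]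
  · ext1 x
    simp [rho_rho_star hs]

/-- The automorphism of `𝔍^C` defined by an element of the spin group. -/
noncomputable def actionEquiv (s : Spin 6) : J ≃ₗ[ℂ] J :=
  LinearEquiv.ofLinearMap (action s.1) (action (star s.1)) (action_mul_action_star s.2) (by
    have h := action_mul_action_star (spinGroup.star_mem s.2)
    rwa [star_star] at h)

/-- The element of the stabilizer defined by an element of the spin group. -/
noncomputable def spinToStab (s : Spin 6) : stab :=
  ⟨⟨actionEquiv s, (isTriality_spin s.2).assemble_jordan⟩, by
    refine ⟨fun i => ?_, ?_, ?_⟩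
    · change action s.1 (E i) = E i
      rw [E_eq_mk, action, assemble_mk]
      simp
    · change action s.1 (F1 (e 0)) = F1 (e 0)
      rw [F1_eq_mk, action, assemble_mk, vecRep_apply, e0_mul, rho_rho_star s.2, map_zero,
        map_zero]
    · change action s.1 (F1 (e 1)) = F1 (e 1)
      rw [F1_eq_mk, action, assemble_mk, vecRep_apply, rho_e1_mul s.2, rho_rho_star s.2, mul_e0,
        map_zero, map_zero]⟩

theorem comp2_action (s : CliffordAlgebra (stdForm 6)) : comp2 (action s) = rho s := rfl

theorem stabToEnd_injective : Function.Injective stabToEnd := by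
  intro α β h
  apply Subtype.ext
  apply Subtype.ext
  exact LinearEquiv.toLinearMap_injective h

/-- The second component determines the other two: the third by conjugation, the first by evaluating
the product relation where the second takes the value `e₀`. -/
theorem action_rhoEquiv_symm_comp2 (α : stab) :
    action (rhoEquiv.symm (comp2 (stabToEnd α))) = stabToEnd α := by
  have hs := rhoEquiv_symm_comp2_mem α
  rw [action, rho_rhoEquiv_symm, ← comp3_eq]
  conv_rhs => rw [stabToEnd_eq_assemble]
  congr 1
  ext1 x
  rw [vecRep_apply, rho_rhoEquiv_symm, ← comp1_mul_comp2]
  have h := rho_rho_star hs (e 0)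
  rw [rho_rhoEquiv_symm] at h
  rw [h, mul_e0]

/-- The stabilizer is isomorphic to the spin group. -/
noncomputable def stabEquivSpin : stab ≃* Spin 6 where
  toFun α := ⟨rhoEquiv.symm (comp2 (stabToEnd α)), rhoEquiv_symm_comp2_mem α⟩
  invFun := spinToStab
  left_inv α := stabToEnd_injective (action_rhoEquiv_symm_comp2 α)
  right_inv s := Subtype.ext <| by
    change rhoEquiv.symm (comp2 (action s.1)) = s.1
    rw [comp2_action]
    exact rhoEquiv.symm_apply_apply s.1
  map_mul' α β := Subtype.ext <| by
    change rhoEquiv.symm (comp2 (stabToEnd (α * β))) =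
      rhoEquiv.symm (comp2 (stabToEnd α)) * rhoEquiv.symm (comp2 (stabToEnd β))
    rw [← map_mul]
    congr 1
    ext1 x
    change entryL 2 0 (stabToEnd α (stabToEnd β (emb2 x))) = _
    rw [stab_emb2]
    rfl

/-! ### Holomorphy -/

section Holomorphy

variable {A B V W : Type*} [AddCommGroup V] [Module ℂ V] [AddCommGroup W] [Module ℂ W]
  [Module.Finite ℂ V] [Module.Finite ℂ W]

/-- A map given by a polynomial of degree at most two is holomorphic. -/
theorem isHolomorphic_of_quadratic {i : A → V} {j : B → W} {f : A → B} (c : W) (ℓ : V →ₗ[ℂ] W)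
    (β : V →ₗ[ℂ] V →ₗ[ℂ] W) (h : ∀ a, j (f a) = c + ℓ (i a) + β (i a) (i a)) :
    IsHolomorphic i j f := by
  let v := (Module.finBasis ℂ V).equivFun
  let w := (Module.finBasis ℂ W).equivFun
  -- One global extension works at every point. Expanding the first slot of `β` in coordinates
  -- reduces differentiability to that of coordinate functions and linear maps.
  refine ⟨_, _, v, w, fun a => ⟨Set.univ, fun x => w c + (w.toLinearMap ∘ₗ ℓ ∘ₗ v.symm) x +
    ∑ k, x k • (w.toLinearMap ∘ₗ β (v.symm (Pi.single k 1)) ∘ₗ v.symm) x, isOpen_univ,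
    Set.mem_univ _, ?_, fun b _ => ?_⟩⟩
  · have hlin : ∀ T : (Fin (Module.finrank ℂ V) → ℂ) →ₗ[ℂ] (Fin (Module.finrank ℂ W) → ℂ),
        Differentiable ℂ T := fun T => T.toContinuousLinearMap.differentiable
    apply Differentiable.differentiableOn
    refine ((differentiable_const _).add (hlin _)).add ?_
    refine Differentiable.fun_sum fun k _ => ?_
    exact (differentiable_apply k).smul (hlin _)
  · have hv : i b = ∑ k, v (i b) k • v.symm (Pi.single k 1) := by
      apply v.injective
      ext l
      simp [map_sum, Pi.single_apply]
    rw [h, map_add, map_add]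
    congr 1
    · simp
    · calc w (β (i b) (i b))
          = w (β (∑ k, v (i b) k • v.symm (Pi.single k 1)) (i b)) := by rw [← hv]
        _ = _ := by simp [LinearMap.sum_apply]

end Holomorphy

/-- Composition with fixed linear maps on both sides. -/
noncomputable def sandwich (p : CayleyC →ₗ[ℂ] J) (q : J →ₗ[ℂ] CayleyC) :
    Module.End ℂ CayleyC →ₗ[ℂ] Module.End ℂ J where
  toFun a := p ∘ₗ a ∘ₗ q
  map_add' a b := by ext1 x; simp
  map_smul' c a := by ext1 x; simp

/-- Since the diagonal is fixed, `assemble` is affine rather than linear; `assemble 0 0 0`, the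
projection to the diagonal, is its constant term. -/
theorem assemble_eq_add (a b c : Module.End ℂ CayleyC) : assemble a b c = assemble 0 0 0 +
    (sandwich emb2 (entryL 2 0) b + sandwich emb3 (entryL 0 1) c) +
      sandwich emb1 (entryL 1 2) a := by
  ext1 X
  apply J_ext <;> simp [assemble_apply, sandwich, emb1_apply, emb2_apply, emb3_apply]

theorem isHolomorphic_stabEquivSpin :
    IsHolomorphic stabToEnd (spinToClifford 6) stabEquivSpin :=
  isHolomorphic_of_quadratic 0 (rhoEquiv.symm.toLinearMap ∘ₗ comp2) 0 fun α => by
    simp only [LinearMap.zero_apply, zero_add, add_zero]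
    rfl

theorem isHolomorphic_stabEquivSpin_symm :
    IsHolomorphic (spinToClifford 6) stabToEnd stabEquivSpin.symm :=
  isHolomorphic_of_quadratic (assemble 0 0 0)
    (sandwich emb2 (entryL 2 0) ∘ₗ rho.toLinearMap +
      sandwich (emb3 ∘ₗ conjL) (conjL ∘ₗ entryL 0 1) ∘ₗ rho.toLinearMap)
    (vecRep.compr₂ (sandwich emb1 (entryL 1 2))) fun s =>
      assemble_eq_add (vecRep s.1 s.1) (rho s.1) (conjL ∘ₗ rho s.1 ∘ₗ conjL)

end F4C

theorem theorem3p16 :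
    ∃ Φ : F4C.stab ≃* F4C.Spin 6,
      F4C.IsHolomorphic F4C.stabToEnd (F4C.spinToClifford 6) Φ ∧
      F4C.IsHolomorphic (F4C.spinToClifford 6) F4C.stabToEnd Φ.symm :=
  ⟨F4C.stabEquivSpin, F4C.isHolomorphic_stabEquivSpin, F4C.isHolomorphic_stabEquivSpin_symm⟩
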